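/- All graphs $G$ below are finite and simple, and a multigraph $R$ is finite, with loops and parallel edges allowed. An *$R$-subdivision* in $G$ is a subgraph of $G$ obtained from $R$ by replacing every non-loop edge $xy$ with a path joining $x$ and $y$ and every loop at $x$ with a cycle through $x$, these paths and cycles being edge-disjoint and meeting each other and the vertices of $R$ only in common ends. It is a *maximum $R$-subdivision* in $G$ if no $R$-subdivision in $G$ has more vertices. A set $S\subseteq V(G)$ *separates* $A,B\subseteq V(G)$ if every path of $G$ that meets $A$ exactly in its first vertex and $B$ exactly in its last vertex contains a vertex of $S$. **Theorem.** For every multigraph $R$ there is a constant $C_R$, depending only on $R$, such that for every graph $G$ and any two maximum $R$-subdivisions $X,Y$ in $G$, with $m=|V(X)\cap V(Y)|$, there is a set $S\subseteq V(G)$ that separates $V(X)$ and $V(Y)$ and satisfies $$|S|\le C_R\,\max(m,1)^{3/2}.$$ In particular, there is an absolute constant $C$ such that for every graph $G$ and any two longest paths $p,q$ in $G$, with $m=|V(p)\cap V(q)|$, there is a set $S\subseteq V(G)$ that separates $V(p)$ and $V(q)$ and satisfies $|S|\le C\max(m,1)^{3/2}$. -/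

import Mathlib

universe u v w

/-- Given a multigraph `R` and a simple graph `G`, the injection `φ` of the
vertices of `R` into `G` and the assignment `P` of a subgraph of `G` to every edge of `R` exhibit
the subgraph `H` of `G` as a subdivision of `R`: a non-loop edge with ends `x`, `y` is replaced by
a path from `φ x` to `φ y`, a loop at `x` by a cycle through `φ x`, these paths and cycles are
edge-disjoint and meet one another and the branch vertices only in images of common ends, and `H`
consists exactly of them and of the branch vertices. -/
structure IsSubdivisionModel {α β W : Type*} {G : SimpleGraph W} (R : Graph α β) (H : G.Subgraph)
    (φ : α → W) (P : β → G.Subgraph) : Prop where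
  branch_injOn : Set.InjOn φ R.vertexSet
  isPath : ∀ e x y, R.IsLink e x y → x ≠ y →
    ∃ p : G.Walk (φ x) (φ y), p.IsPath ∧ p.toSubgraph = P e
  isCycle : ∀ e x, R.IsLoopAt e x →
    ∃ c : G.Walk (φ x) (φ x), c.IsCycle ∧ c.toSubgraph = P e
  branch_mem : ∀ e ∈ R.edgeSet, ∀ z ∈ R.vertexSet, φ z ∈ (P e).verts → R.Inc e z
  internally_disjoint : ∀ e ∈ R.edgeSet, ∀ f ∈ R.edgeSet, e ≠ f →
    ∀ w ∈ (P e).verts ∩ (P f).verts, ∃ z, R.Inc e z ∧ R.Inc f z ∧ φ z = w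
  edge_disjoint : ∀ e ∈ R.edgeSet, ∀ f ∈ R.edgeSet, e ≠ f →
    Disjoint (P e).edgeSet (P f).edgeSet
  verts_eq : H.verts = φ '' R.vertexSet ∪ ⋃ e ∈ R.edgeSet, (P e).verts
  edgeSet_eq : H.edgeSet = ⋃ e ∈ R.edgeSet, (P e).edgeSet

/-- The subgraph `H` of `G` is an `R`-subdivision. -/
def IsSubdivision {α β W : Type*} {G : SimpleGraph W} (R : Graph α β) (H : G.Subgraph) : Prop :=
  ∃ (φ : α → W) (P : β → G.Subgraph), IsSubdivisionModel R H φ P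

/-- A maximum `R`-subdivision in `G`: an `R`-subdivision in `G` with the maximum number of
vertices (used for finite `G`). -/
def IsMaximumSubdivision {α β W : Type*} {G : SimpleGraph W} (R : Graph α β) (H : G.Subgraph) :
    Prop :=
  IsSubdivision R H ∧ ∀ K : G.Subgraph, IsSubdivision R K → K.verts.ncard ≤ H.verts.ncard

/-- A longest path of `G`. -/
def IsLongestPath {W : Type*} {G : SimpleGraph W} {a b : W} (p : G.Walk a b) : Prop :=
  p.IsPath ∧ ∀ (c d : W) (q : G.Walk c d), q.IsPath → q.length ≤ p.length

/-- An `(A, B)`-path: a path meeting `A` exactly in its first vertex and `B` exactly in its last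
vertex. -/
def IsABPath {W : Type*} {G : SimpleGraph W} (A B : Set W) {a b : W} (p : G.Walk a b) : Prop :=
  p.IsPath ∧ {v | v ∈ p.support} ∩ A = {a} ∧ {v | v ∈ p.support} ∩ B = {b}

/-- The vertex set `S` separates `A` and `B` in `G`: every `(A, B)`-path meets `S`. -/
def SeparatesSets {W : Type*} (G : SimpleGraph W) (S A B : Set W) : Prop :=
  ∀ (a b : W) (p : G.Walk a b), IsABPath A B p → ∃ v ∈ p.support, v ∈ S

/-! By Menger's theorem it suffices to bound the number of disjoint `X`–`Y` paths ("links"). At most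
`m` links start in `X ∩ Y`, and at most `2|V(R)|` end in branch vertices. Each remaining link joins
the interior of a subdivided edge of `X` to one of `Y`. So it suffices to bound, for each of the
`|E(R)|²` pairs of interiors, the number of links between them (`IsLinkSystem.card_sq_le`).

Fix two such interiors, tracks `f` in `X` and `g` in `Y`. The engine is an exchange
(`exchange_false`): reroute `f` through links and pieces of `g`, and at the same time `g` through
the same links and pieces of `f`, the pieces being clean, that is, avoiding the other subdivision.
If everything dropped by one track is used by the other, then neither the union nor the intersection
of the two vertex sets shrinks. The intersection strictly grows, since the link ends used become
common. So one of the two subdivisions gets larger, against maximality.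

The other subdivision cuts each track into at most `s = m + 1` clean segments. An exchange along two
links shows that two segments are joined by at most one link (`eq_of_clean`). The links thus form a
bipartite graph on `s + s` segments. If it has more than `√12 · s^(3/2)` edges, double counting
gives segments `i < k < j < l` of `f` such that both `i, j` and `k, l` have at least eight common
neighbours. By pigeonhole, each of the two pairs lies in a 4-cycle of links (`IsLinkSquare`) whose
orientations agree on its two segments of `g`, and the two squares can be taken to occupy separate
stretches of `g`. One square with agreeing orientations on `f` as well permits an exchange. If they
disagree (`reversed`), rerouting `f` along one square alone would split off a cycle, but the two
interleaved squares together give a single path again (`reroute_cross`), and the exchange along both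
is a contradiction (`cross_false`). -/

open Set

/-! ### Concatenating paths given by their ends and vertex sets -/

/-- There is a path of `G` from `a` to `b` whose vertex set is `S`. -/
def PathOn {W : Type*} (G : SimpleGraph W) (a b : W) (S : Set W) : Prop :=
  ∃ p : G.Walk a b, p.IsPath ∧ {v | v ∈ p.support} = S

/-- The distinct vertices `b` and `c` are joined by a path with set of interior vertices `I`. -/
def JoinedVia {W : Type*} (G : SimpleGraph W) (b c : W) (I : Set W) : Prop :=
  b ≠ c ∧ b ∉ I ∧ c ∉ I ∧ PathOn G b c (insert b (insert c I))

namespace PathOn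

variable {W : Type*} {G : SimpleGraph W} {a b c d : W} {S T I : Set W}

lemma left_mem (h : PathOn G a b S) : a ∈ S := by
  obtain ⟨p, -, rfl⟩ := h
  exact p.start_mem_support

lemma right_mem (h : PathOn G a b S) : b ∈ S := by
  obtain ⟨p, -, rfl⟩ := h
  exact p.end_mem_support

lemma refl (G : SimpleGraph W) (a : W) : PathOn G a a {a} :=
  ⟨.nil, .nil, by ext; simp⟩

lemma symm (h : PathOn G a b S) : PathOn G b a S := by
  obtain ⟨p, hp, rfl⟩ := h
  exact ⟨p.reverse, hp.reverse, by ext; simp⟩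

lemma mono {G' : SimpleGraph W} (hG : G ≤ G') (h : PathOn G a b S) : PathOn G' a b S := by
  obtain ⟨p, hp, rfl⟩ := h
  exact ⟨p.mapLe hG, by simpa using hp, by ext; simp⟩

lemma glue (h : PathOn G a b S) (h' : PathOn G b c T) (hST : S ∩ T ⊆ {b}) :
    PathOn G a c (S ∪ T) := by
  obtain ⟨p, hp, rfl⟩ := h
  obtain ⟨q, hq, rfl⟩ := h'
  refine ⟨p.append q, ?_, by ext; simp [SimpleGraph.Walk.mem_support_append_iff]⟩
  rw [SimpleGraph.Walk.isPath_def, SimpleGraph.Walk.support_append, List.nodup_append']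
  refine ⟨hp.support_nodup, hq.support_nodup.tail, ?_⟩
  intro v hv hv'
  have : v = b := hST ⟨hv, List.mem_of_mem_tail hv'⟩
  subst this
  have := hq.support_nodup
  rw [← q.cons_tail_support] at this
  exact (List.nodup_cons.1 this).1 hv'

lemma of_adj (h : G.Adj a b) : PathOn G a b {a, b} :=
  ⟨h.toWalk, h.isPath_toWalk, by ext; simp⟩

lemma join (h : PathOn G a b S) (hbc : G.Adj b c) (h' : PathOn G c d T) (hST : Disjoint S T) :
    PathOn G a d (S ∪ T) := by
  have h1 := h.glue (of_adj hbc) (by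
    rintro v ⟨hv, rfl | rfl⟩
    · rfl
    · exact (hST.le_bot ⟨hv, h'.left_mem⟩).elim)
  have h2 := h1.glue h' (by
    rintro v ⟨hv | rfl | rfl, hv'⟩
    · exact (hST.le_bot ⟨hv, hv'⟩).elim
    · exact (hST.le_bot ⟨h.right_mem, hv'⟩).elim
    · rfl)
  convert h2 using 1
  ext v
  have := h.right_mem
  have := h'.left_mem
  simp only [mem_union, mem_insert_iff, mem_singleton_iff]
  grind

lemma trans_joined (h : PathOn G a b S) (hbc : JoinedVia G b c I) (h' : PathOn G c d T)
    (hSI : Disjoint S I) (hST : Disjoint S T) (hIT : Disjoint I T) :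
    PathOn G a d (S ∪ I ∪ T) := by
  obtain ⟨hne, hb, hc, hp⟩ := hbc
  have h1 := h.glue hp (by
    rintro v ⟨hv, rfl | rfl | hv'⟩
    · rfl
    · exact (hST.le_bot ⟨hv, h'.left_mem⟩).elim
    · exact (hSI.le_bot ⟨hv, hv'⟩).elim)
  have h2 := h1.glue h' (by
    rintro v ⟨hv | rfl | rfl | hv, hv'⟩
    · exact (hST.le_bot ⟨hv, hv'⟩).elim
    · exact (hST.le_bot ⟨h.right_mem, hv'⟩).elim
    · rfl
    · exact (hIT.le_bot ⟨hv, hv'⟩).elim)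
  convert h2 using 1
  ext v
  have := h.right_mem
  have := h'.left_mem
  simp only [mem_union, mem_insert_iff]
  grind

end PathOn

namespace JoinedVia

variable {W : Type*} {G : SimpleGraph W} {a b c d : W} {T I J : Set W}

lemma symm (h : JoinedVia G a b I) : JoinedVia G b a I :=
  ⟨h.1.symm, h.2.2.1, h.2.1, by rw [insert_comm]; exact h.2.2.2.symm⟩

lemma through (h : JoinedVia G a c I) (h' : PathOn G c d T) (h'' : JoinedVia G d b J) (hab : a ≠ b)
    (haT : a ∉ T) (haJ : a ∉ J) (hbI : b ∉ I) (hbT : b ∉ T) (hIT : Disjoint I T)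
    (hIJ : Disjoint I J) (hTJ : Disjoint T J) : JoinedVia G a b (I ∪ T ∪ J) := by
  obtain ⟨hne, ha, hc, hp⟩ := h
  obtain ⟨hne', hd, hb, hp'⟩ := h''
  refine ⟨hab, by simp [*], by simp [*], ?_⟩
  have h1 := hp.glue h' (by
    rintro v ⟨rfl | rfl | hv, hv'⟩
    · exact (haT hv').elim
    · rfl
    · exact (hIT.le_bot ⟨hv, hv'⟩).elim)
  have h2 := h1.glue hp' (by
    rintro v ⟨(rfl | rfl | hv) | hv, rfl | rfl | hv'⟩
    · exact (haT h'.right_mem).elim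
    · exact (hab rfl).elim
    · exact (haJ hv').elim
    · rfl
    · exact (hbT h'.left_mem).elim
    · exact (hTJ.le_bot ⟨h'.left_mem, hv'⟩).elim
    · rfl
    · exact (hbI hv).elim
    · exact (hIJ.le_bot ⟨hv, hv'⟩).elim
    · rfl
    · exact (hbT hv).elim
    · exact (hTJ.le_bot ⟨hv, hv'⟩).elim)
  convert h2 using 1
  ext v
  have := h'.right_mem
  have := h'.left_mem
  simp only [mem_union, mem_insert_iff]
  grind

end JoinedVia

/-! ### Menger's theorem by induction on the number of edges -/

section Menger

variable {W : Type*}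

/-- Every walk of `G` from `A` to `B` meets `S`. -/
def WalkSeparates (G : SimpleGraph W) (S A B : Set W) : Prop :=
  ∀ a ∈ A, ∀ b ∈ B, ∀ p : G.Walk a b, ∃ v ∈ p.support, v ∈ S

/-- Some walk of `G` from `A` to `v` avoids `S`. -/
def ReachesAvoiding (G : SimpleGraph W) (S A : Set W) (v : W) : Prop :=
  ∃ a ∈ A, ∃ p : G.Walk a v, ∀ w ∈ p.support, w ∉ S

variable {G : SimpleGraph W} {S A B : Set W}

lemma ReachesAvoiding.not_mem {v : W} (h : ReachesAvoiding G S A v) : v ∉ S := by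
  obtain ⟨a, -, p, hp⟩ := h
  exact hp v p.end_mem_support

lemma ReachesAvoiding.of_mem {v : W} (hv : v ∈ A) (hS : v ∉ S) : ReachesAvoiding G S A v :=
  ⟨v, hv, .nil, by simpa using hS⟩

lemma ReachesAvoiding.adj {v w : W} (h : ReachesAvoiding G S A v) (hvw : G.Adj v w) (hw : w ∉ S) :
    ReachesAvoiding G S A w := by
  obtain ⟨a, ha, p, hp⟩ := h
  refine ⟨a, ha, p.concat hvw, fun u hu => ?_⟩
  simp only [SimpleGraph.Walk.support_concat, List.mem_append, List.mem_singleton] at hu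
  rcases hu with hu | rfl
  · exact hp u hu
  · exact hw

lemma ReachesAvoiding.walk {v w : W} (h : ReachesAvoiding G S A v) (q : G.Walk v w)
    (hq : ∀ u ∈ q.support, u ∉ S) : ReachesAvoiding G S A w := by
  obtain ⟨a, ha, p, hp⟩ := h
  refine ⟨a, ha, p.append q, fun u hu => ?_⟩
  rw [SimpleGraph.Walk.mem_support_append_iff] at hu
  exact hu.elim (hp u) (hq u)

lemma ReachesAvoiding.symm {u v : W} (h : ReachesAvoiding G S {u} v) :
    ReachesAvoiding G S {v} u := by
  obtain ⟨a, rfl, p, hp⟩ := h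
  exact ⟨v, rfl, p.reverse, by simpa using hp⟩

lemma walkSeparates_iff : WalkSeparates G S A B ↔ ∀ b ∈ B, ¬ ReachesAvoiding G S A b := by
  constructor
  · rintro h b hb ⟨a, ha, p, hp⟩
    obtain ⟨v, hv, hvS⟩ := h a ha b hb p
    exact hp v hv hvS
  · intro h a ha b hb p
    by_contra! hc
    exact h b hb ⟨a, ha, p, hc⟩

lemma WalkSeparates.symm (h : WalkSeparates G S A B) : WalkSeparates G S B A := by
  intro b hb a ha p
  obtain ⟨v, hv, hvS⟩ := h a ha b hb p.reverse
  exact ⟨v, by simpa using hv, hvS⟩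

lemma ReachesAvoiding.induction {P : W → Prop} (h0 : ∀ a ∈ A, a ∉ S → P a)
    (h1 : ∀ v w, P v → G.Adj v w → w ∉ S → P w) {v : W} (h : ReachesAvoiding G S A v) : P v := by
  obtain ⟨a, ha, p, hp⟩ := h
  have key : ∀ {a v : W} (p : G.Walk a v), P a → (∀ w ∈ p.support, w ∉ S) → P v := by
    intro a v p
    induction p with
    | nil => exact fun h _ => h
    | cons hadj q ih =>
      intro hPa hw
      refine ih (h1 _ _ hPa hadj (hw _ ?_)) fun w hw' => hw w ?_
      · simp
      · simp [hw']
  exact key p (h0 a ha (hp a p.start_mem_support)) hp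

lemma ReachesAvoiding.mono {S' A' : Set W} {G' : SimpleGraph W} (hG : G ≤ G') (hS : S' ⊆ S)
    (hA : A ⊆ A') {v : W} (h : ReachesAvoiding G S A v) : ReachesAvoiding G' S' A' v := by
  obtain ⟨a, ha, p, hp⟩ := h
  exact ⟨a, hA ha, p.mapLe hG, fun w hw hwS => hp w (by simpa using hw) (hS hwS)⟩

lemma adj_deleteEdges_or {x y v w : W} (h : G.Adj v w) :
    (G.deleteEdges {s(x, y)}).Adj v w ∨ (v = x ∧ w = y) ∨ (v = y ∧ w = x) := by
  by_cases hc : s(v, w) = s(x, y)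
  · right
    simpa using hc
  · left
    simp [SimpleGraph.deleteEdges_adj, h, hc]

lemma exists_reaches_of_not_walkSeparates {x y : W}
    (hS : WalkSeparates (G.deleteEdges {s(x, y)}) S A B) (hS' : ¬ WalkSeparates G S A B) :
    (ReachesAvoiding (G.deleteEdges {s(x, y)}) S A x ∧
        ReachesAvoiding (G.deleteEdges {s(x, y)}) S B y) ∨
      (ReachesAvoiding (G.deleteEdges {s(x, y)}) S A y ∧
        ReachesAvoiding (G.deleteEdges {s(x, y)}) S B x) := by
  rw [walkSeparates_iff] at hS hS'
  push Not at hS'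
  obtain ⟨b, hb, hr⟩ := hS'
  set G' := G.deleteEdges {s(x, y)}
  -- Invariant along a walk avoiding `S`: the current vertex is reached without the edge `xy`,
  -- either from `A` or from one end of `xy` while `A` reaches the other end. Crossing `xy` again
  -- leads back to one of these cases.
  have key : ReachesAvoiding G' S A b ∨
      (ReachesAvoiding G' S A x ∧ ReachesAvoiding G' S {y} b) ∨
      (ReachesAvoiding G' S A y ∧ ReachesAvoiding G' S {x} b) := by
    refine ReachesAvoiding.induction (P := fun v => ReachesAvoiding G' S A v ∨
      (ReachesAvoiding G' S A x ∧ ReachesAvoiding G' S {y} v) ∨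
      (ReachesAvoiding G' S A y ∧ ReachesAvoiding G' S {x} v)) ?_ ?_ hr
    · exact fun a ha haS => .inl (.of_mem ha haS)
    · intro v w hv hvw hw
      rcases adj_deleteEdges_or (x := x) (y := y) hvw with h | ⟨rfl, rfl⟩ | ⟨rfl, rfl⟩
      · rcases hv with hv | ⟨h1, h2⟩ | ⟨h1, h2⟩
        · exact .inl (hv.adj h hw)
        · exact .inr (.inl ⟨h1, h2.adj h hw⟩)
        · exact .inr (.inr ⟨h1, h2.adj h hw⟩)
      · rcases hv with hv | ⟨h1, h2⟩ | ⟨h1, h2⟩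
        · exact .inr (.inl ⟨hv, .of_mem rfl hw⟩)
        · exact .inr (.inl ⟨h1, .of_mem rfl hw⟩)
        · exact .inl h1
      · rcases hv with hv | ⟨h1, h2⟩ | ⟨h1, h2⟩
        · exact .inr (.inr ⟨hv, .of_mem rfl hw⟩)
        · exact .inl h1
        · exact .inr (.inr ⟨h1, .of_mem rfl hw⟩)
  rcases key with h | ⟨h1, h2⟩ | ⟨h1, h2⟩
  · exact (hS b hb h).elim
  · exact .inl ⟨h1, h2.symm.mono le_rfl subset_rfl (by simpa using hb)⟩
  · exact .inr ⟨h1, h2.symm.mono le_rfl subset_rfl (by simpa using hb)⟩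

lemma not_reachesAvoiding_both (hS : WalkSeparates G S A B) {v : W}
    (hA : ReachesAvoiding G S A v) (hB : ReachesAvoiding G S B v) : False := by
  obtain ⟨b, hb, q, hq⟩ := hB
  exact walkSeparates_iff.1 hS b hb (hA.walk q.reverse (by simpa using hq))

/-- A walk from `A` that avoids `Z` cannot use the edge `xy`: it never gets to `x`, which lies
behind `Z`, nor to `y`, which lies behind `S`. Hence it stays in the smaller graph and avoids `S`
too, so it never arrives in `B`. -/
lemma WalkSeparates.of_deleteEdges_insert {Z : Set W} {x y : W}
    (hS : WalkSeparates (G.deleteEdges {s(x, y)}) S A B)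
    (hy : ¬ ReachesAvoiding (G.deleteEdges {s(x, y)}) S A y)
    (hZ : WalkSeparates (G.deleteEdges {s(x, y)}) Z A (insert x S)) :
    WalkSeparates G Z A B := by
  rw [walkSeparates_iff] at hS hZ ⊢
  intro b hb hr
  set G' := G.deleteEdges {s(x, y)}
  have key : ReachesAvoiding G' (Z ∪ insert x S) A b := by
    refine ReachesAvoiding.induction (fun a ha haZ => ?_) (fun v w hv hvw hw => ?_) hr
    · exact .of_mem ha fun h => h.elim haZ fun h => hZ a h (.of_mem ha haZ)
    · rcases adj_deleteEdges_or (x := x) (y := y) hvw with h | ⟨rfl, rfl⟩ | ⟨rfl, rfl⟩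
      · have := (hv.mono le_rfl subset_union_left subset_rfl).adj h hw
        exact hv.adj h fun hc => hc.elim hw fun hc => hZ w hc this
      · exact (hv.not_mem (by simp)).elim
      · exact (hy (hv.mono le_rfl (by intro u; simp +contextual) subset_rfl)).elim
  exact hS b hb (key.mono le_rfl (by intro u; simp +contextual) subset_rfl)

/-- Disjoint paths into `T`, as many as `T` has vertices, use each vertex of `T` as an end exactly
once and can be indexed by it. No path then has room for a second vertex of `T`, so all its vertices
but the last are reached avoiding `T`. -/
lemma exists_indexed_linkage [Finite W] {T : Set W} (F : Fin T.ncard → Set W)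
    (hF : ∀ i, ∃ a ∈ A, ∃ b ∈ T, PathOn G a b (F i)) (hd : Pairwise (Function.onFun Disjoint F)) :
    ∃ H : W → Set W, (∀ s ∈ T, (∃ a ∈ A, PathOn G a s (H s)) ∧
        ∀ v ∈ H s, v = s ∨ ReachesAvoiding G T A v) ∧
      ∀ s ∈ T, ∀ t ∈ T, s ≠ t → Disjoint (H s) (H t) := by
  classical
  choose α hα β hβ hp using hF
  have hinj : Function.Injective fun i => (⟨β i, hβ i⟩ : T) := by
    intro i j hij
    by_contra hne
    have hij' : β i = β j := congrArg Subtype.val hij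
    exact (hd hne).le_bot ⟨(hp i).right_mem, hij' ▸ (hp j).right_mem⟩
  have hbij : Function.Bijective fun i => (⟨β i, hβ i⟩ : T) := by
    have := Fintype.ofFinite T
    rw [Fintype.bijective_iff_injective_and_card]
    refine ⟨hinj, ?_⟩
    rw [Fintype.card_fin, ← Nat.card_coe_set_eq, Nat.card_eq_fintype_card]
  let e := Equiv.ofBijective _ hbij
  have he : ∀ i, (e i : W) = β i := fun i => rfl
  refine ⟨fun s => if h : s ∈ T then F (e.symm ⟨s, h⟩) else ∅, ?_, ?_⟩
  · intro s hs
    obtain ⟨i, hi⟩ := e.surjective ⟨s, hs⟩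
    have hi' : β i = s := congrArg Subtype.val hi
    simp only [hs, dif_pos, ← hi, Equiv.symm_apply_apply]
    refine ⟨⟨α i, hα i, hi' ▸ hp i⟩, fun v hv => ?_⟩
    rw [or_iff_not_imp_left]
    intro hvs
    obtain ⟨p, hpp, hpF⟩ := hp i
    have hvp : v ∈ p.support := by rw [← hpF] at hv; exact hv
    refine ⟨α i, hα i, p.takeUntil v hvp, fun w hw hwT => ?_⟩
    obtain ⟨j, hj⟩ := e.surjective ⟨w, hwT⟩
    have hj' : β j = w := congrArg Subtype.val hj
    have hwF : w ∈ F i := by rw [← hpF]; exact p.support_takeUntil_subset_support hvp hw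
    have hji : j = i := by
      by_contra hne
      exact (hd hne).le_bot ⟨(hp j).right_mem, hj' ▸ hwF⟩
    subst hji
    subst hj'
    exact SimpleGraph.Walk.endpoint_notMem_support_takeUntil hpp hvp (by rw [hi']; exact fun h => hvs h.symm) hw
  · intro s hs t ht hst
    simp only [hs, ht, dif_pos]
    exact hd fun h => hst (congrArg Subtype.val (e.symm.injective h))

/-- Menger's theorem for two sets of vertices of a finite graph. -/
theorem exists_disjoint_paths [Finite W] (G : SimpleGraph W) (A B : Set W) (k : ℕ)
    (h : ∀ S, WalkSeparates G S A B → k ≤ S.ncard) :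
    ∃ F : Fin k → Set W, (∀ i, ∃ a ∈ A, ∃ b ∈ B, PathOn G a b (F i)) ∧
      Pairwise (Function.onFun Disjoint F) := by
  classical
  have := Fintype.ofFinite W
  induction hn : G.edgeSet.ncard using Nat.strong_induction_on generalizing G A B k with
  | _ n ih =>
  subst hn
  rcases eq_or_ne G ⊥ with rfl | hG
  · have hsep : WalkSeparates (⊥ : SimpleGraph W) (A ∩ B) A B := by
      intro a ha b hb p
      cases p with
      | nil => exact ⟨a, by simp, ha, hb⟩
      | cons h _ => simp at h
    obtain ⟨T, hT, hTk⟩ := Set.exists_subset_card_eq (h _ hsep)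
    have e : T ≃ Fin k := Finite.equivFinOfCardEq (by rw [Nat.card_coe_set_eq, hTk])
    refine ⟨fun i => {(e.symm i : W)}, fun i => ?_, fun i j hij => ?_⟩
    · have := hT (e.symm i).2
      exact ⟨_, this.1, _, this.2, .refl _ _⟩
    · simpa [Function.onFun, Subtype.val_inj] using hij
  obtain ⟨x, y, hxy⟩ : ∃ x y, G.Adj x y := by
    by_contra! hc
    exact hG (by ext u v; simpa using hc u v)
  set G' := G.deleteEdges {s(x, y)} with hG'
  have hle : G' ≤ G := SimpleGraph.deleteEdges_le _
  have hlt : G'.edgeSet.ncard < G.edgeSet.ncard := by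
    refine Set.ncard_lt_ncard ⟨SimpleGraph.edgeSet_subset_edgeSet.2 hle, fun hc => ?_⟩
    have : s(x, y) ∈ G'.edgeSet := hc hxy
    simp [hG'] at this
  by_cases hS : ∀ S, WalkSeparates G' S A B → k ≤ S.ncard
  · obtain ⟨F, hF, hd⟩ := ih _ hlt G' A B k hS rfl
    refine ⟨F, fun i => ?_, hd⟩
    obtain ⟨a, ha, b, hb, hp⟩ := hF i
    exact ⟨a, ha, b, hb, hp.mono hle⟩
  push Not at hS
  obtain ⟨S, hS, hSk⟩ := hS
  have hS' : ¬ WalkSeparates G S A B := fun hc => absurd (h S hc) (by omega)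
  clear_value G'
  wlog hr : ReachesAvoiding G' S A x ∧ ReachesAvoiding G' S B y generalizing x y
  · refine this y x hxy.symm (by rw [hG', Sym2.eq_swap]) ?_
    have := exists_reaches_of_not_walkSeparates (hG' ▸ hS) hS'
    rw [← hG'] at this
    exact this.resolve_left hr
  obtain ⟨hAx, hBy⟩ := hr
  have hxS := hAx.not_mem
  have hyS := hBy.not_mem
  have hAy : ¬ ReachesAvoiding G' S A y := fun hc => not_reachesAvoiding_both hS hc hBy
  have hBx : ¬ ReachesAvoiding G' S B x := fun hc => not_reachesAvoiding_both hS hAx hc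
  -- Since `S` has fewer than `k` vertices, adding `x` or `y` gives exactly `k`. Induction then
  -- links `A` to `S ∪ {x}` and `B` to `S ∪ {y}` completely.
  have hsepx : ∀ Z, WalkSeparates G' Z A (insert x S) → k ≤ Z.ncard := fun Z hZ =>
    h Z (WalkSeparates.of_deleteEdges_insert (hG' ▸ hS) (hG' ▸ hAy) (hG' ▸ hZ))
  have hG'' : G' = G.deleteEdges {s(y, x)} := by rw [hG', Sym2.eq_swap]
  have hsepy : ∀ Z, WalkSeparates G' Z B (insert y S) → k ≤ Z.ncard := fun Z hZ =>
    h Z (WalkSeparates.of_deleteEdges_insert (hG'' ▸ hS.symm) (hG'' ▸ hBx) (hG'' ▸ hZ)).symm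
  have hkx : (insert x S).ncard = k := by
    refine le_antisymm ((Set.ncard_insert_le _ _).trans hSk) (hsepx _ ?_)
    exact fun a ha b hb p => ⟨b, p.end_mem_support, hb⟩
  have hky : (insert y S).ncard = k := by
    refine le_antisymm ((Set.ncard_insert_le _ _).trans hSk) (hsepy _ ?_)
    exact fun a ha b hb p => ⟨b, p.end_mem_support, hb⟩
  obtain ⟨F, hF, hFd⟩ := ih _ hlt G' A (insert x S) _ (hkx ▸ hsepx) rfl
  obtain ⟨Q, hQ, hQd⟩ := ih _ hlt G' B (insert y S) _ (hky ▸ hsepy) rfl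
  obtain ⟨F, hF, hFd⟩ := exists_indexed_linkage F hF hFd
  obtain ⟨Q, hQ, hQd⟩ := exists_indexed_linkage Q hQ hQd
  have hFm : ∀ s ∈ insert x S, ∀ v ∈ F s, (v = s ∧ v ∈ S) ∨ ReachesAvoiding G' S A v := by
    intro s hs v hv
    rcases (hF s hs).2 v hv with rfl | hr
    · rcases hs with rfl | hs
      · exact .inr hAx
      · exact .inl ⟨rfl, hs⟩
    · exact .inr (hr.mono le_rfl (subset_insert _ _) subset_rfl)
  have hQm : ∀ s ∈ insert y S, ∀ v ∈ Q s, (v = s ∧ v ∈ S) ∨ ReachesAvoiding G' S B v := by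
    intro s hs v hv
    rcases (hQ s hs).2 v hv with rfl | hr
    · rcases hs with rfl | hs
      · exact .inr hBy
      · exact .inl ⟨rfl, hs⟩
    · exact .inr (hr.mono le_rfl (subset_insert _ _) subset_rfl)
  -- Outside `S` the two linkages live on the `A`-side and on the `B`-side of the separator, which
  -- are disjoint.
  have hFQ : ∀ s ∈ insert x S, ∀ t ∈ insert y S, ∀ v ∈ F s, v ∈ Q t → v = s ∧ v = t ∧ v ∈ S := by
    intro s hs t ht v hv hv'
    rcases hFm s hs v hv with ⟨h1, h2⟩ | h1 <;> rcases hQm t ht v hv' with ⟨h3, h4⟩ | h3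
    · exact ⟨h1, h3, h2⟩
    · exact (h3.not_mem h2).elim
    · exact (h1.not_mem h4).elim
    · exact (not_reachesAvoiding_both hS h1 h3).elim
  -- The path ending in `x` is continued across the edge `xy`, every other one at its own end in
  -- `S`.
  let τ : W → W := fun s => if s = x then y else s
  have hτ : ∀ s ∈ insert x S, τ s ∈ insert y S := by
    rintro s (rfl | hs)
    · simp [τ]
    · have : s ≠ x := fun h => hxS (h ▸ hs)
      simp [τ, this, hs]
  have hτinj : ∀ s ∈ insert x S, ∀ t ∈ insert x S, τ s = τ t → s = t := by
    intro s hs t ht hst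
    simp only [τ] at hst
    split_ifs at hst with h1 h2 h2
    · rw [h1, h2]
    · subst hst
      exact (hyS (ht.resolve_left h2)).elim
    · subst hst
      exact (hyS (hs.resolve_left h1)).elim
    · exact hst
  have hτS : ∀ s ∈ insert x S, s ∈ S → τ s = s := by
    intro s _ hs
    have : s ≠ x := fun h => hxS (h ▸ hs)
    simp [τ, this]
  have e : (insert x S : Set W) ≃ Fin k :=
    Finite.equivFinOfCardEq (by rw [Nat.card_coe_set_eq, hkx])
  refine ⟨fun i => F (e.symm i) ∪ Q (τ (e.symm i)), fun i => ?_, fun i j hij => ?_⟩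
  · have hs := (e.symm i).2
    beta_reduce
    generalize (e.symm i : W) = s at hs
    obtain ⟨⟨a, ha, hp⟩, -⟩ := hF s hs
    obtain ⟨⟨b, hb, hq⟩, -⟩ := hQ _ (hτ s hs)
    refine ⟨a, ha, b, hb, ?_⟩
    rcases eq_or_ne s x with rfl | hsx
    · have hτs : τ s = y := by simp [τ]
      simp only [hτs] at hq ⊢
      refine (hp.mono hle).join hxy (hq.symm.mono hle) ?_
      rw [Set.disjoint_left]
      intro v hv hv'
      obtain ⟨rfl, -, h2⟩ := hFQ s hs y (by simp) v hv hv'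
      exact hxS h2
    · have hτs : τ s = s := by simp [τ, hsx]
      simp only [hτs] at hq ⊢
      refine (hp.mono hle).glue (hq.symm.mono hle) ?_
      rintro v ⟨hv, hv'⟩
      exact (hFQ s hs s (by simpa [hτs] using hτ s hs) v hv hv').1
  · have hne : (e.symm i : W) ≠ e.symm j := fun hc => hij (e.symm.injective (Subtype.ext hc))
    have hi := (e.symm i).2
    have hj := (e.symm j).2
    have aux : ∀ s ∈ insert x S, ∀ t ∈ insert x S, s ≠ t → Disjoint (F s) (Q (τ t)) := by
      intro s hs t ht hst
      rw [Set.disjoint_left]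
      intro v hv hv'
      obtain ⟨h1, h2, h3⟩ := hFQ s hs _ (hτ t ht) v hv hv'
      refine hst (hτinj s hs t ht ?_)
      rw [hτS s hs (h1 ▸ h3), ← h2, h1]
    simp only [Function.onFun, Set.disjoint_union_left, Set.disjoint_union_right]
    exact ⟨⟨hFd _ hi _ hj hne, (aux _ hj _ hi hne.symm).symm⟩, aux _ hi _ hj hne,
      hQd _ (hτ _ hi) _ (hτ _ hj) fun hc => hne (hτinj _ hi _ hj hc)⟩

/-- A path from `A` to `B` contains an `(A, B)`-path. -/
lemma PathOn.exists_subset_inter_eq {a b : W} {F : Set W} (ha : a ∈ A) (hb : b ∈ B)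
    (h : PathOn G a b F) :
    ∃ a' ∈ A, ∃ b' ∈ B, ∃ F' ⊆ F, PathOn G a' b' F' ∧ F' ∩ A = {a'} ∧ F' ∩ B = {b'} := by
  classical
  obtain ⟨p, -, rfl⟩ := h
  induction hn : p.length using Nat.strong_induction_on generalizing a b with
  | _ n ih =>
  subst hn
  by_cases hp : p.IsPath ∧ (∀ v ∈ p.support, v ∈ A → v = a) ∧ (∀ v ∈ p.support, v ∈ B → v = b)
  · refine ⟨a, ha, b, hb, _, subset_rfl, ⟨p, hp.1, rfl⟩, ?_, ?_⟩
    · ext v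
      exact ⟨fun hv => hp.2.1 v hv.1 hv.2, by rintro rfl; exact ⟨p.start_mem_support, ha⟩⟩
    · ext v
      exact ⟨fun hv => hp.2.2 v hv.1 hv.2, by rintro rfl; exact ⟨p.end_mem_support, hb⟩⟩
  -- Otherwise a shorter walk exists on the same vertices: start at a later vertex of `A`, stop at
  -- an earlier vertex of `B`, or bypass a repetition.
  have main : ∃ a' ∈ A, ∃ b' ∈ B, ∃ q : G.Walk a' b', q.length < p.length ∧
      q.support ⊆ p.support := by
    by_cases hpp : p.IsPath
    · rw [not_and, not_and_or] at hp
      rcases hp hpp with hc | hc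
      · push Not at hc
        obtain ⟨v, hv, hvA, hva⟩ := hc
        refine ⟨v, hvA, b, hb, p.dropUntil v hv, ?_, p.support_dropUntil_subset_support hv⟩
        have h1 := congrArg SimpleGraph.Walk.length (p.take_spec hv)
        rw [SimpleGraph.Walk.length_append] at h1
        have h2 : (p.takeUntil v hv).length ≠ 0 := fun h0 =>
          hva (SimpleGraph.Walk.eq_of_length_eq_zero h0).symm
        omega
      · push Not at hc
        obtain ⟨v, hv, hvB, hvb⟩ := hc
        refine ⟨a, ha, v, hvB, p.takeUntil v hv, ?_, p.support_takeUntil_subset_support hv⟩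
        have h1 := congrArg SimpleGraph.Walk.length (p.take_spec hv)
        rw [SimpleGraph.Walk.length_append] at h1
        have h2 : (p.dropUntil v hv).length ≠ 0 := fun h0 =>
          hvb (SimpleGraph.Walk.eq_of_length_eq_zero h0)
        omega
    · refine ⟨a, ha, b, hb, p.bypass, ?_, p.support_bypass_subset_support⟩
      refine lt_of_le_of_ne p.length_bypass_le_length fun hc => hpp ?_
      rw [← SimpleGraph.Walk.bypass_eq_self_of_length_le_length_bypass p hc.ge]
      exact p.bypass_isPath
  obtain ⟨a', ha', b', hb', q, hq, hqs⟩ := main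
  obtain ⟨c, hc, d, hd, F', hF', h⟩ := ih _ hq ha' hb' q rfl
  exact ⟨c, hc, d, hd, F', fun v hv => hqs (hF' hv), h⟩

end Menger

/-! ### Rerouting a path along chords -/

/-- The vertices `f 0, …, f n` form, in this order, a path of `G`. -/
structure IsTrack {W : Type*} (G : SimpleGraph W) (f : ℕ → W) (n : ℕ) : Prop where
  inj : ∀ i ≤ n, ∀ j ≤ n, f i = f j → i = j
  adj : ∀ i < n, G.Adj (f i) (f (i + 1))

lemma PathOn.exists_isTrack {W : Type*} {G : SimpleGraph W} {a b : W} {S : Set W}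
    (h : PathOn G a b S) :
    ∃ (f : ℕ → W) (n : ℕ), IsTrack G f n ∧ f 0 = a ∧ f n = b ∧ f '' Icc 0 n = S := by
  obtain ⟨p, hp, rfl⟩ := h
  refine ⟨p.getVert, p.length, ⟨fun i hi j hj => hp.getVert_injOn hi hj,
    fun i hi => p.adj_getVert_succ hi⟩, p.getVert_zero, p.getVert_length, ?_⟩
  ext v
  simp [SimpleGraph.Walk.mem_support_iff_exists_getVert, and_comm]

namespace IsTrack

variable {W : Type*} {G : SimpleGraph W} {f : ℕ → W} {n : ℕ}

lemma disjoint_image (hf : IsTrack G f n) {A B : Set ℕ} (hA : ∀ i ∈ A, i ≤ n)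
    (hB : ∀ i ∈ B, i ≤ n) (h : Disjoint A B) : Disjoint (f '' A) (f '' B) := by
  rw [Set.disjoint_left]
  rintro _ ⟨i, hi, rfl⟩ ⟨j, hj, hij⟩
  have := hf.inj j (hB j hj) i (hA i hi) hij
  exact h.le_bot ⟨hi, this ▸ hj⟩

lemma disjoint_image_Icc (hf : IsTrack G f n) {i j k l : ℕ} (hjk : j < k) (hj : j ≤ n)
    (hl : l ≤ n) : Disjoint (f '' Icc i j) (f '' Icc k l) := by
  refine hf.disjoint_image (fun _ h => h.2.trans hj) (fun _ h => h.2.trans hl) ?_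
  rw [Set.disjoint_left]
  rintro a ⟨h1, h2⟩ ⟨h3, h4⟩
  omega

lemma pathOn (hf : IsTrack G f n) {i j : ℕ} (hij : i ≤ j) (hj : j ≤ n) :
    PathOn G (f i) (f j) (f '' Icc i j) := by
  induction j, hij using Nat.le_induction with
  | base => simpa using PathOn.refl G (f i)
  | succ j hij ih =>
    have h := (ih (by omega)).join (hf.adj j (by omega)) (.refl G _) (by
      have := hf.disjoint_image_Icc (i := i) (l := j + 1) (Nat.lt_succ_self j) (by omega) hj
      simpa using this)
    convert h using 1
    rw [← image_singleton, ← image_union]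
    congr 1
    ext a
    simp only [mem_Icc, mem_union, mem_singleton_iff]
    omega

lemma pathOn_uIcc (hf : IsTrack G f n) {i j : ℕ} (hi : i ≤ n) (hj : j ≤ n) :
    PathOn G (f i) (f j) (f '' uIcc i j) := by
  rcases le_total i j with h | h
  · rw [uIcc_of_le h]
    exact hf.pathOn h hj
  · rw [uIcc_of_ge h]
    exact (hf.pathOn h hi).symm

lemma reroute_one (hf : IsTrack G f n) {a b : ℕ} {I : Set W} (hab : a ≠ b) (ha : a ≤ n)
    (hb : b ≤ n) (hJ : JoinedVia G (f a) (f b) I) (hI : Disjoint I (f '' Icc 0 n)) :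
    PathOn G (f 0) (f n) (f '' (Icc 0 n \ uIoo a b) ∪ I) := by
  wlog hlt : a < b generalizing a b
  · rw [uIoo_comm]
    exact this hab.symm hb ha hJ.symm (by omega)
  have hm : ∀ {i j}, j ≤ n → Disjoint I (f '' Icc i j) := fun hj =>
    hI.mono_right (image_mono (Icc_subset_Icc (Nat.zero_le _) hj))
  have h := (hf.pathOn (Nat.zero_le a) ha).trans_joined hJ (hf.pathOn hb le_rfl) (hm ha).symm
    (hf.disjoint_image_Icc hlt ha le_rfl) (hm le_rfl)
  have hU : Icc 0 n \ uIoo a b = Icc 0 a ∪ Icc b n := by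
    ext i
    simp only [uIoo, mem_sdiff, mem_Icc, mem_Ioo, mem_union]
    omega
  rw [hU, image_union, union_right_comm]
  exact h

/-- For `a₁ < a₂` and `b₁ < b₂`: run to `a₁`, jump to `b₁`, run backwards to `a₂`, jump to `b₂` and
go on. Only the two gaps between neighbouring chord ends are lost. With opposite orders the middle
part would close up to a cycle. -/
lemma reroute_two (hf : IsTrack G f n) {lo hi a₁ a₂ b₁ b₂ : ℕ} {I₁ I₂ : Set W}
    (ha₁ : lo ≤ a₁) (ha₂ : lo ≤ a₂) (hb₁ : b₁ ≤ hi) (hb₂ : b₂ ≤ hi) (hhi : hi ≤ n)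
    (hane : a₁ ≠ a₂) (hbne : b₁ ≠ b₂) (hiff : a₁ < a₂ ↔ b₁ < b₂)
    (h₁₁ : a₁ < b₁) (h₁₂ : a₁ < b₂) (h₂₁ : a₂ < b₁) (h₂₂ : a₂ < b₂)
    (hJ₁ : JoinedVia G (f a₁) (f b₁) I₁) (hJ₂ : JoinedVia G (f a₂) (f b₂) I₂)
    (hI₁ : Disjoint I₁ (f '' Icc 0 n)) (hI₂ : Disjoint I₂ (f '' Icc 0 n)) (hI : Disjoint I₁ I₂) :
    PathOn G (f lo) (f hi)
      (f '' (Icc lo hi \ (uIoo a₁ a₂ ∪ uIoo b₁ b₂)) ∪ (I₁ ∪ I₂)) := by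
  wlog hlt : a₁ < a₂ generalizing a₁ a₂ b₁ b₂ I₁ I₂
  · rw [uIoo_comm a₁, uIoo_comm b₁, union_comm I₁]
    exact this ha₂ ha₁ hb₂ hb₁ hane.symm hbne.symm (by omega) h₂₂ h₂₁ h₁₂ h₁₁ hJ₂ hJ₁ hI₂ hI₁
      hI.symm (by omega)
  have hltb := hiff.1 hlt
  have hm : ∀ {I : Set W} {i j}, Disjoint I (f '' Icc 0 n) → j ≤ n → Disjoint I (f '' Icc i j) :=
    fun hI hj => hI.mono_right (image_mono (Icc_subset_Icc (Nat.zero_le _) hj))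
  have h := (hf.pathOn ha₁ (by omega)).trans_joined hJ₁
    (hf.pathOn h₂₁.le (by omega)).symm (hm hI₁ (by omega)).symm
    (hf.disjoint_image_Icc hlt (by omega) (by omega)) (hm hI₁ (by omega))
  have h' := h.trans_joined hJ₂ (hf.pathOn hb₂ hhi)
    (by
      simp only [disjoint_union_left]
      exact ⟨⟨(hm hI₂ (by omega)).symm, hI⟩, (hm hI₂ (by omega)).symm⟩)
    (by
      simp only [disjoint_union_left]
      exact ⟨⟨hf.disjoint_image_Icc (by omega) (by omega) hhi, hm hI₁ hhi⟩,
        hf.disjoint_image_Icc (by omega) (by omega) hhi⟩)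
    (hm hI₂ hhi)
  have hU : Icc lo hi \ (uIoo a₁ a₂ ∪ uIoo b₁ b₂) = Icc lo a₁ ∪ Icc a₂ b₁ ∪ Icc b₂ hi := by
    ext i
    simp only [uIoo, mem_sdiff, mem_Icc, mem_Ioo, mem_union]
    omega
  rw [hU, image_union, image_union]
  convert h' using 1
  ac_rfl

/-- Two interleaved pairs of chords, each of the bad orientation, repair each other. The path visits
`0 … a₁`, `b₁ … d₂`, `c₂ … b₂`, `a₂ … c₁`, `d₁ … n`, every piece in forward direction. -/
lemma reroute_cross (hf : IsTrack G f n) {a₁ a₂ b₁ b₂ c₁ c₂ d₁ d₂ : ℕ} {I₁ I₂ I₃ I₄ : Set W}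
    (hac : a₁ < a₂ ∧ a₂ < c₁ ∧ c₁ < c₂) (hcb : c₂ < b₂) (hbd : b₂ < b₁ ∧ b₁ < d₂ ∧ d₂ < d₁)
    (hd : d₁ ≤ n)
    (hJ₁ : JoinedVia G (f a₁) (f b₁) I₁) (hJ₂ : JoinedVia G (f a₂) (f b₂) I₂)
    (hJ₃ : JoinedVia G (f c₁) (f d₁) I₃) (hJ₄ : JoinedVia G (f c₂) (f d₂) I₄)
    (hI₁ : Disjoint I₁ (f '' Icc 0 n)) (hI₂ : Disjoint I₂ (f '' Icc 0 n))
    (hI₃ : Disjoint I₃ (f '' Icc 0 n)) (hI₄ : Disjoint I₄ (f '' Icc 0 n))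
    (h₁₂ : Disjoint I₁ I₂) (h₁₃ : Disjoint I₁ I₃) (h₁₄ : Disjoint I₁ I₄)
    (h₂₃ : Disjoint I₂ I₃) (h₂₄ : Disjoint I₂ I₄) (h₃₄ : Disjoint I₃ I₄) :
    PathOn G (f 0) (f n)
      (f '' (Icc 0 n \ (uIoo a₁ a₂ ∪ uIoo b₁ b₂ ∪ (uIoo c₁ c₂ ∪ uIoo d₁ d₂))) ∪
        (I₁ ∪ I₂ ∪ (I₃ ∪ I₄))) := by
  obtain ⟨o1, o2, o3⟩ := hac
  obtain ⟨o4, o5, o6⟩ := hbd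
  have hm : ∀ {I : Set W} {i j}, Disjoint I (f '' Icc 0 n) → j ≤ n → Disjoint I (f '' Icc i j) :=
    fun hI hj => hI.mono_right (image_mono (Icc_subset_Icc (Nat.zero_le _) hj))
  have hs : ∀ {i j k l}, j < k → l ≤ n → j ≤ n → Disjoint (f '' Icc i j) (f '' Icc k l) :=
    fun h h' h'' => hf.disjoint_image_Icc h h'' h'
  have p1 := (hf.pathOn (Nat.zero_le a₁) (by omega)).trans_joined hJ₁
    (hf.pathOn o5.le (by omega)) (hm hI₁ (by omega)).symm
    (hs (by omega) (by omega) (by omega)) (hm hI₁ (by omega))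
  have p2 := p1.trans_joined hJ₄.symm (hf.pathOn hcb.le (by omega))
    (by
      simp only [disjoint_union_left]
      exact ⟨⟨(hm hI₄ (by omega)).symm, h₁₄⟩, (hm hI₄ (by omega)).symm⟩)
    (by
      simp only [disjoint_union_left]
      exact ⟨⟨hs (by omega) (by omega) (by omega), hm hI₁ (by omega)⟩,
        (hs (by omega) (by omega) (by omega)).symm⟩)
    (hm hI₄ (by omega))
  have p3 := p2.trans_joined hJ₂.symm (hf.pathOn o2.le (by omega))
    (by
      simp only [disjoint_union_left]
      exact ⟨⟨⟨⟨(hm hI₂ (by omega)).symm, h₁₂⟩, (hm hI₂ (by omega)).symm⟩, h₂₄.symm⟩,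
        (hm hI₂ (by omega)).symm⟩)
    (by
      simp only [disjoint_union_left]
      exact ⟨⟨⟨⟨hs (by omega) (by omega) (by omega), hm hI₁ (by omega)⟩,
        (hs (by omega) (by omega) (by omega)).symm⟩, hm hI₄ (by omega)⟩,
        (hs (by omega) (by omega) (by omega)).symm⟩)
    (hm hI₂ (by omega))
  have p4 := p3.trans_joined hJ₃ (hf.pathOn hd le_rfl)
    (by
      simp only [disjoint_union_left]
      exact ⟨⟨⟨⟨⟨⟨(hm hI₃ (by omega)).symm, h₁₃⟩, (hm hI₃ (by omega)).symm⟩, h₃₄.symm⟩,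
        (hm hI₃ (by omega)).symm⟩, h₂₃⟩, (hm hI₃ (by omega)).symm⟩)
    (by
      simp only [disjoint_union_left]
      exact ⟨⟨⟨⟨⟨⟨hs (by omega) (by omega) (by omega), hm hI₁ (by omega)⟩,
        hs (by omega) (by omega) (by omega)⟩, hm hI₄ (by omega)⟩,
        hs (by omega) (by omega) (by omega)⟩, hm hI₂ (by omega)⟩,
        hs (by omega) (by omega) (by omega)⟩)
    (hm hI₃ (by omega))
  have hU : Icc 0 n \ (uIoo a₁ a₂ ∪ uIoo b₁ b₂ ∪ (uIoo c₁ c₂ ∪ uIoo d₁ d₂)) =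
      Icc 0 a₁ ∪ Icc a₂ c₁ ∪ Icc c₂ b₂ ∪ Icc b₁ d₂ ∪ Icc d₁ n := by
    ext i
    simp only [uIoo, mem_sdiff, mem_Icc, mem_Ioo, mem_union]
    omega
  rw [hU, image_union, image_union, image_union, image_union]
  convert p4 using 1
  ac_rfl

lemma reroute_cross' (hf : IsTrack G f n) {a₁ a₂ b₁ b₂ c₁ c₂ d₁ d₂ : ℕ} {I₁ I₂ I₃ I₄ : Set W}
    (hane : a₁ ≠ a₂) (hbne : b₁ ≠ b₂) (hab : ¬ (a₁ < a₂ ↔ b₁ < b₂))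
    (hcne : c₁ ≠ c₂) (hdne : d₁ ≠ d₂) (hcd : ¬ (c₁ < c₂ ↔ d₁ < d₂))
    (hac : max a₁ a₂ < min c₁ c₂) (hcb : max c₁ c₂ < min b₁ b₂) (hbd : max b₁ b₂ < min d₁ d₂)
    (hd : max d₁ d₂ ≤ n)
    (hJ₁ : JoinedVia G (f a₁) (f b₁) I₁) (hJ₂ : JoinedVia G (f a₂) (f b₂) I₂)
    (hJ₃ : JoinedVia G (f c₁) (f d₁) I₃) (hJ₄ : JoinedVia G (f c₂) (f d₂) I₄)
    (hI₁ : Disjoint I₁ (f '' Icc 0 n)) (hI₂ : Disjoint I₂ (f '' Icc 0 n))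
    (hI₃ : Disjoint I₃ (f '' Icc 0 n)) (hI₄ : Disjoint I₄ (f '' Icc 0 n))
    (h₁₂ : Disjoint I₁ I₂) (h₁₃ : Disjoint I₁ I₃) (h₁₄ : Disjoint I₁ I₄)
    (h₂₃ : Disjoint I₂ I₃) (h₂₄ : Disjoint I₂ I₄) (h₃₄ : Disjoint I₃ I₄) :
    PathOn G (f 0) (f n)
      (f '' (Icc 0 n \ (uIoo a₁ a₂ ∪ uIoo b₁ b₂ ∪ (uIoo c₁ c₂ ∪ uIoo d₁ d₂))) ∪
        (I₁ ∪ I₂ ∪ (I₃ ∪ I₄))) := by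
  wlog hlt : a₁ < a₂ generalizing a₁ a₂ b₁ b₂ I₁ I₂
  · rw [uIoo_comm a₁, uIoo_comm b₁, union_comm I₁]
    exact this hane.symm hbne.symm (by omega) (by omega) (by omega) (by omega) hJ₂ hJ₁ hI₂ hI₁
      h₁₂.symm h₂₃ h₂₄ h₁₃ h₁₄ (by omega)
  wlog hlt' : c₁ < c₂ generalizing c₁ c₂ d₁ d₂ I₃ I₄
  · rw [uIoo_comm c₁, uIoo_comm d₁, union_comm I₃]
    exact this hcne.symm hdne.symm (by omega) (by omega) hJ₄ hJ₃ hI₄ hI₃ h₃₄.symm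
      (by omega) (by omega) (by omega) h₁₄ h₁₃ h₂₄ h₂₃ (by omega)
  exact hf.reroute_cross (by omega) (by omega) (by omega) (by omega) hJ₁ hJ₂ hJ₃ hJ₄ hI₁ hI₂ hI₃
    hI₄ h₁₂ h₁₃ h₁₄ h₂₃ h₂₄ h₃₄

/-- Allows independent reroutings of an initial and a final part of the track, joined by the edge
that follows position `c`. -/
lemma pathOn_append (hf : IsTrack G f n) {c : ℕ} (hc : c < n) {R R' : Set ℕ} {J J' : Set W}
    (h : PathOn G (f 0) (f c) (f '' (Icc 0 c \ R) ∪ J))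
    (h' : PathOn G (f (c + 1)) (f n) (f '' (Icc (c + 1) n \ R') ∪ J'))
    (hR : ∀ i ∈ R, i ≤ c) (hR' : ∀ i ∈ R', c < i) (hJ : Disjoint J (f '' Icc 0 n))
    (hJ' : Disjoint J' (f '' Icc 0 n)) (hJJ' : Disjoint J J') :
    PathOn G (f 0) (f n) (f '' (Icc 0 n \ (R ∪ R')) ∪ (J ∪ J')) := by
  have hm : ∀ {I : Set W} {A : Set ℕ}, (∀ i ∈ A, i ≤ n) → Disjoint I (f '' Icc 0 n) →
      Disjoint I (f '' A) := fun hA hI =>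
    hI.mono_right (image_mono fun i hi => mem_Icc.2 ⟨Nat.zero_le _, hA i hi⟩)
  have h1 : ∀ i ∈ Icc 0 c \ R, i ≤ n := fun i hi => hi.1.2.trans hc.le
  have h2 : ∀ i ∈ Icc (c + 1) n \ R', i ≤ n := fun i hi => hi.1.2
  have p := h.join (hf.adj c hc) h' (by
    rw [disjoint_union_left, disjoint_union_right, disjoint_union_right]
    refine ⟨⟨hf.disjoint_image h1 h2 ?_, (hm h1 hJ').symm⟩, hm h2 hJ, hJJ'⟩
    rw [Set.disjoint_left]
    rintro i ⟨⟨-, h1⟩, -⟩ ⟨⟨h2, -⟩, -⟩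
    omega)
  have hU : Icc 0 n \ (R ∪ R') = (Icc 0 c \ R) ∪ (Icc (c + 1) n \ R') := by
    ext i
    have := hR i
    have := hR' i
    simp only [mem_sdiff, mem_Icc, mem_union]
    grind
  rw [hU, image_union]
  convert p using 1
  ac_rfl

end IsTrack

/-! ### Exchanges between two linked tracks -/

/-- The track `f 0, …, f n` inside `X` cannot be replaced by another path with the same ends so
that the number of vertices of `X` increases. -/
def Unimprovable {W : Type*} (G : SimpleGraph W) (X : Set W) (f : ℕ → W) (n : ℕ) : Prop :=
  ∀ S, PathOn G (f 0) (f n) S → Disjoint S (X \ f '' Icc 0 n) →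
    ((X \ f '' Icc 0 n) ∪ S).ncard ≤ X.ncard

/-- A family of disjoint paths, indexed by `T` and otherwise disjoint from `X` and `Y`, from a
track `f` of `X` outside of `Y` to a track `g` of `Y` outside of `X`, for unimprovable tracks. -/
structure IsLinkSystem {W ι : Type*} (G : SimpleGraph W) (X Y : Set W) (f g : ℕ → W) (n n' : ℕ)
    (T : Set ι) (x y : ι → ℕ) (Λ : ι → Set W) : Prop where
  track_f : IsTrack G f n
  track_g : IsTrack G g n'
  f_mem : ∀ i ≤ n, f i ∈ X
  g_mem : ∀ i ≤ n', g i ∈ Y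
  max_f : Unimprovable G X f n
  max_g : Unimprovable G Y g n'
  x_le : ∀ t ∈ T, x t ≤ n
  y_le : ∀ t ∈ T, y t ≤ n'
  x_notMem : ∀ t ∈ T, f (x t) ∉ Y
  y_notMem : ∀ t ∈ T, g (y t) ∉ X
  joined : ∀ t ∈ T, JoinedVia G (f (x t)) (g (y t)) (Λ t)
  disj : ∀ t ∈ T, Disjoint (Λ t) (X ∪ Y)
  pairwise : ∀ t ∈ T, ∀ u ∈ T, t ≠ u → Disjoint (Λ t) (Λ u)
  x_inj : ∀ t ∈ T, ∀ u ∈ T, x t = x u → t = u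
  y_inj : ∀ t ∈ T, ∀ u ∈ T, y t = y u → t = u

/-- The interior of the path that consists of the links `t` and `u` and of the part of the track
`g` between them. -/
def viaSet {W ι : Type*} (g : ℕ → W) (y : ι → ℕ) (Λ : ι → Set W) (t u : ι) : Set W :=
  Λ t ∪ g '' uIcc (y t) (y u) ∪ Λ u

/-- The part of the track `f` between positions `i` and `j` avoids `Y`. -/
def CleanOn {W : Type*} (f : ℕ → W) (Y : Set W) (i j : ℕ) : Prop :=
  ∀ k ∈ uIcc i j, f k ∉ Y

lemma le_of_mem_uIcc {i j k n : ℕ} (hk : k ∈ uIcc i j) (hi : i ≤ n) (hj : j ≤ n) : k ≤ n := by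
  rw [mem_uIcc] at hk
  omega

namespace IsLinkSystem

variable {W ι : Type*} {G : SimpleGraph W} {X Y : Set W} {f g : ℕ → W} {n n' : ℕ}
  {T : Set ι} {x y : ι → ℕ} {Λ : ι → Set W}

lemma swap (L : IsLinkSystem G X Y f g n n' T x y Λ) :
    IsLinkSystem G Y X g f n' n T y x Λ where
  track_f := L.track_g
  track_g := L.track_f
  f_mem := L.g_mem
  g_mem := L.f_mem
  max_f := L.max_g
  max_g := L.max_f
  x_le := L.y_le
  y_le := L.x_le
  x_notMem := L.y_notMem
  y_notMem := L.x_notMem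
  joined t ht := (L.joined t ht).symm
  disj t ht := union_comm X Y ▸ L.disj t ht
  pairwise := L.pairwise
  x_inj := L.y_inj
  y_inj := L.x_inj

lemma disjoint_link_f (L : IsLinkSystem G X Y f g n n' T x y Λ) {t : ι} (ht : t ∈ T) {A : Set ℕ}
    (hA : ∀ i ∈ A, i ≤ n) : Disjoint (Λ t) (f '' A) := by
  refine (L.disj t ht).mono_right ?_
  rintro _ ⟨i, hi, rfl⟩
  exact .inl (L.f_mem i (hA i hi))

lemma disjoint_link_g (L : IsLinkSystem G X Y f g n n' T x y Λ) {t : ι} (ht : t ∈ T) {A : Set ℕ}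
    (hA : ∀ i ∈ A, i ≤ n') : Disjoint (Λ t) (g '' A) :=
  L.swap.disjoint_link_f ht hA

/-- Two links and a clean piece of `g` between them serve as a chord of `f`; cleanness keeps this
piece off `X`, hence off `f`. -/
lemma joinedVia (L : IsLinkSystem G X Y f g n n' T x y Λ) {t u : ι} (ht : t ∈ T) (hu : u ∈ T)
    (htu : t ≠ u) (hc : CleanOn g X (y t) (y u)) :
    JoinedVia G (f (x t)) (f (x u)) (viaSet g y Λ t u) := by
  have hle : ∀ i ∈ uIcc (y t) (y u), i ≤ n' := fun i hi =>
    le_of_mem_uIcc hi (L.y_le t ht) (L.y_le u hu)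
  have hX : ∀ v ∈ T, f (x v) ∈ X := fun v hv => L.f_mem _ (L.x_le v hv)
  have hΛ : ∀ v ∈ T, ∀ w ∈ T, f (x v) ∉ Λ w := fun v hv w hw h =>
    (L.disj w hw).le_bot ⟨h, .inl (hX v hv)⟩
  have hT : ∀ v ∈ T, f (x v) ∉ g '' uIcc (y t) (y u) := by
    rintro v hv ⟨k, hk, hkv⟩
    exact hc k hk (hkv ▸ hX v hv)
  exact (L.joined t ht).through (L.track_g.pathOn_uIcc (L.y_le t ht) (L.y_le u hu))
    (L.joined u hu).symm
    (fun h => htu (L.x_inj t ht u hu (L.track_f.inj _ (L.x_le t ht) _ (L.x_le u hu) h)))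
    (hT t ht) (hΛ t ht u hu) (hΛ u hu t ht) (hT u hu) (L.disjoint_link_g ht hle)
    (L.pairwise t ht u hu htu) (L.disjoint_link_g hu hle).symm

lemma viaSet_disjoint_track (L : IsLinkSystem G X Y f g n n' T x y Λ) {t u : ι} (ht : t ∈ T)
    (hu : u ∈ T) (hc : CleanOn g X (y t) (y u)) :
    Disjoint (viaSet g y Λ t u) (f '' Icc 0 n) := by
  simp only [viaSet, disjoint_union_left]
  refine ⟨⟨L.disjoint_link_f ht fun i hi => hi.2, ?_⟩, L.disjoint_link_f hu fun i hi => hi.2⟩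
  rw [Set.disjoint_left]
  rintro _ ⟨k, hk, rfl⟩ ⟨i, hi, hik⟩
  exact hc k hk (hik ▸ L.f_mem i hi.2)

lemma viaSet_disjoint_viaSet (L : IsLinkSystem G X Y f g n n' T x y Λ) {t u t' u' : ι}
    (ht : t ∈ T) (hu : u ∈ T) (ht' : t' ∈ T) (hu' : u' ∈ T)
    (h : max (y t) (y u) < min (y t') (y u')) :
    Disjoint (viaSet g y Λ t u) (viaSet g y Λ t' u') := by
  have h1 : ∀ i ∈ uIcc (y t) (y u), i ≤ n' := fun i hi =>
    le_of_mem_uIcc hi (L.y_le t ht) (L.y_le u hu)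
  have h2 : ∀ i ∈ uIcc (y t') (y u'), i ≤ n' := fun i hi =>
    le_of_mem_uIcc hi (L.y_le t' ht') (L.y_le u' hu')
  have h3 : Disjoint (uIcc (y t) (y u)) (uIcc (y t') (y u')) := by
    rw [Set.disjoint_left]
    intro i hi hi'
    rw [mem_uIcc] at hi hi'
    omega
  have hne : ∀ {v w}, y v < y w → v ≠ w := fun hlt h => hlt.ne (congrArg y h)
  simp only [viaSet, disjoint_union_left, disjoint_union_right]
  exact ⟨⟨⟨⟨L.pairwise _ ht _ ht' (hne (by omega)), (L.disjoint_link_g ht' h1).symm⟩,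
    L.pairwise _ hu _ ht' (hne (by omega))⟩, ⟨L.disjoint_link_g ht h2,
    L.track_g.disjoint_image h1 h2 h3⟩, L.disjoint_link_g hu h2⟩,
    ⟨L.pairwise _ ht _ hu' (hne (by omega)), (L.disjoint_link_g hu' h1).symm⟩,
    L.pairwise _ hu _ hu' (hne (by omega))⟩

/-- Simultaneously exchanging parts of the two tracks would increase one of the two sets. -/
lemma exchange_false [Finite W] (L : IsLinkSystem G X Y f g n n' T x y Λ) {U B U' B' : Set ℕ}
    {M : Set W} (hP : PathOn G (f 0) (f n) (f '' (Icc 0 n \ U) ∪ (g '' B' ∪ M)))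
    (hQ : PathOn G (g 0) (g n') (g '' (Icc 0 n' \ U') ∪ (f '' B ∪ M)))
    (hUB : U ⊆ B) (hUB' : U' ⊆ B') (hBn : ∀ i ∈ B, i ≤ n)
    (hB : ∀ i ∈ B, f i ∉ Y) (hB' : ∀ i ∈ B', g i ∉ X) (hM : Disjoint M (X ∪ Y))
    {b : ℕ} (hbB : b ∈ B) (hbU : b ∉ U) : False := by
  have hMX : ∀ v ∈ M, v ∉ X := fun v hv h => hM.le_bot ⟨hv, .inl h⟩
  have hMY : ∀ v ∈ M, v ∉ Y := fun v hv h => hM.le_bot ⟨hv, .inr h⟩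
  have h1 := L.max_f _ hP (by
    rw [Set.disjoint_left]
    rintro _ (⟨i, hi, rfl⟩ | ⟨i, hi, rfl⟩ | hv) ⟨hX, hS⟩
    · exact hS ⟨i, hi.1, rfl⟩
    · exact hB' i hi hX
    · exact hMX _ hv hX)
  have h2 := L.max_g _ hQ (by
    rw [Set.disjoint_left]
    rintro _ (⟨i, hi, rfl⟩ | ⟨i, hi, rfl⟩ | hv) ⟨hY, hS⟩
    · exact hS ⟨i, hi.1, rfl⟩
    · exact hB i hi hY
    · exact hMY _ hv hY)
  set X' := (X \ f '' Icc 0 n) ∪ (f '' (Icc 0 n \ U) ∪ (g '' B' ∪ M))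
  set Y' := (Y \ g '' Icc 0 n') ∪ (g '' (Icc 0 n' \ U') ∪ (f '' B ∪ M))
  have hXX' : ∀ v ∈ X, v ∈ X' ∨ ∃ i ∈ U, i ≤ n ∧ f i = v := by
    intro v hv
    by_cases h : v ∈ f '' Icc 0 n
    · obtain ⟨i, hi, rfl⟩ := h
      by_cases hiU : i ∈ U
      · exact .inr ⟨i, hiU, hi.2, rfl⟩
      · exact .inl (.inr (.inl ⟨i, ⟨hi, hiU⟩, rfl⟩))
    · exact .inl (.inl ⟨hv, h⟩)
  have hYY' : ∀ v ∈ Y, v ∈ Y' ∨ ∃ i ∈ U', i ≤ n' ∧ g i = v := by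
    intro v hv
    by_cases h : v ∈ g '' Icc 0 n'
    · obtain ⟨i, hi, rfl⟩ := h
      by_cases hiU : i ∈ U'
      · exact .inr ⟨i, hiU, hi.2, rfl⟩
      · exact .inl (.inr (.inl ⟨i, ⟨hi, hiU⟩, rfl⟩))
    · exact .inl (.inl ⟨hv, h⟩)
  -- What one track drops is picked up by the other, so the union does not shrink.
  have hun : X ∪ Y ⊆ X' ∪ Y' := by
    rintro v (hv | hv)
    · rcases hXX' v hv with h | ⟨i, hi, -, rfl⟩
      · exact .inl h
      · exact .inr (.inr (.inr (.inl ⟨i, hUB hi, rfl⟩)))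
    · rcases hYY' v hv with h | ⟨i, hi, -, rfl⟩
      · exact .inr h
      · exact .inl (.inr (.inr (.inl ⟨i, hUB' hi, rfl⟩)))
  -- Dropped vertices were not common to both sets. The vertex `f b` is new in the intersection: it
  -- is kept by the first track and used by the second. As sizes of union and intersection add up to
  -- the sum of the two sizes, that sum increases.
  have hin : X ∩ Y ⊂ X' ∩ Y' := by
    refine ⟨?_, fun hc => hB b hbB (hc (a := f b) ⟨?_, ?_⟩).2⟩
    · rintro v ⟨hv, hv'⟩
      constructor
      · rcases hXX' v hv with h | ⟨i, hi, -, rfl⟩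
        · exact h
        · exact (hB i (hUB hi) hv').elim
      · rcases hYY' v hv' with h | ⟨i, hi, -, rfl⟩
        · exact h
        · exact (hB' i (hUB' hi) hv).elim
    · exact .inr (.inl ⟨b, ⟨⟨Nat.zero_le _, hBn b hbB⟩, hbU⟩, rfl⟩)
    · exact .inr (.inr (.inl ⟨b, hbB, rfl⟩))
  have h3 := Set.ncard_le_ncard hun
  have h4 := Set.ncard_lt_ncard hin
  have h5 := Set.ncard_union_add_ncard_inter X Y
  have h6 := Set.ncard_union_add_ncard_inter X' Y'
  omega

lemma uIoo_subset_uIcc (i j : ℕ) : uIoo i j ⊆ uIcc i j := by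
  intro k hk
  simp only [uIoo, mem_Ioo] at hk
  rw [mem_uIcc]
  omega

/-- Two different links between the same clean pieces would let the tracks swap the parts between
their ends. The positions lost form open intervals, those gained closed ones, so the ends of the
links become common. -/
lemma eq_of_clean [Finite W] (L : IsLinkSystem G X Y f g n n' T x y Λ) {t u : ι} (ht : t ∈ T)
    (hu : u ∈ T) (hx : CleanOn f Y (x t) (x u)) (hy : CleanOn g X (y t) (y u)) : t = u := by
  by_contra htu
  have hxne : x t ≠ x u := fun h => htu (L.x_inj t ht u hu h)
  have hyne : y t ≠ y u := fun h => htu (L.y_inj t ht u hu h)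
  refine L.exchange_false (U := uIoo (x t) (x u)) (B := uIcc (x t) (x u))
    (U' := uIoo (y t) (y u)) (B' := uIcc (y t) (y u)) (M := Λ t ∪ Λ u) (b := x t)
    ?_ ?_ (uIoo_subset_uIcc _ _) (uIoo_subset_uIcc _ _)
    (fun i hi => le_of_mem_uIcc hi (L.x_le t ht) (L.x_le u hu))
    hx hy ?_ left_mem_uIcc ?_
  · convert L.track_f.reroute_one hxne (L.x_le t ht) (L.x_le u hu) (L.joinedVia ht hu htu hy)
      (L.viaSet_disjoint_track ht hu hy) using 2
    simp only [viaSet]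
    ac_rfl
  · convert L.track_g.reroute_one hyne (L.y_le t ht) (L.y_le u hu) (L.swap.joinedVia ht hu htu hx)
      (L.swap.viaSet_disjoint_track ht hu hx) using 2
    simp only [viaSet]
    ac_rfl
  · exact disjoint_union_left.2 ⟨L.disj t ht, L.disj u hu⟩
  · simp only [uIoo, mem_Ioo]
    omega

end IsLinkSystem

/-! ### Exchanges along squares of links -/

/-- Four links joining two clean parts of the track `f` with two clean parts of the track `g`, such
that the two ends of the links follow each other in the same order on both parts of `g`. -/
structure IsLinkSquare {W ι : Type*} (X Y : Set W) (f g : ℕ → W) (T : Set ι) (x y : ι → ℕ)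
    (t u t' u' : ι) : Prop where
  ht : t ∈ T
  hu : u ∈ T
  ht' : t' ∈ T
  hu' : u' ∈ T
  x_lt : max (x t) (x u) < min (x t') (x u')
  y_lt : max (y t) (y t') < min (y u) (y u')
  x_clean : CleanOn f Y (x t) (x u)
  x_clean' : CleanOn f Y (x t') (x u')
  y_clean : CleanOn g X (y t) (y t')
  y_clean' : CleanOn g X (y u) (y u')
  sign : y t < y t' ↔ y u < y u'

namespace IsLinkSquare

variable {W ι : Type*} {G : SimpleGraph W} {X Y : Set W} {f g : ℕ → W} {n n' : ℕ}
  {T : Set ι} {x y : ι → ℕ} {Λ : ι → Set W} {t u t' u' : ι}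

lemma ne_tu (h : IsLinkSquare X Y f g T x y t u t' u') : t ≠ u := by
  rintro rfl
  have := h.y_lt
  omega

lemma ne_tu' (h : IsLinkSquare X Y f g T x y t u t' u') : t' ≠ u' := by
  rintro rfl
  have := h.y_lt
  omega

lemma ne_tt' (h : IsLinkSquare X Y f g T x y t u t' u') : t ≠ t' := by
  rintro rfl
  have := h.x_lt
  omega

lemma ne_uu' (h : IsLinkSquare X Y f g T x y t u t' u') : u ≠ u' := by
  rintro rfl
  have := h.x_lt
  omega

/-- The positions of the track `f` lost in the exchange given by a square. -/
def removed (x : ι → ℕ) (t u t' u' : ι) : Set ℕ := uIoo (x t) (x u) ∪ uIoo (x t') (x u')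

/-- The positions of the track `f` used by the other track in the exchange given by a square. -/
def used (x : ι → ℕ) (t u t' u' : ι) : Set ℕ := uIcc (x t) (x u) ∪ uIcc (x t') (x u')

lemma removed_subset_used : removed x t u t' u' ⊆ used x t u t' u' :=
  union_subset_union (IsLinkSystem.uIoo_subset_uIcc _ _) (IsLinkSystem.uIoo_subset_uIcc _ _)

lemma notMem_removed (h : IsLinkSquare X Y f g T x y t u t' u') : x t ∉ removed x t u t' u' := by
  have := h.x_lt
  simp only [removed, uIoo, mem_union, mem_Ioo]
  omega

lemma le_of_mem_used (h : IsLinkSquare X Y f g T x y t u t' u')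
    (L : IsLinkSystem G X Y f g n n' T x y Λ) : ∀ i ∈ used x t u t' u', i ≤ n := by
  rintro i (hi | hi)
  · exact le_of_mem_uIcc hi (L.x_le _ h.ht) (L.x_le _ h.hu)
  · exact le_of_mem_uIcc hi (L.x_le _ h.ht') (L.x_le _ h.hu')

lemma clean_used (h : IsLinkSquare X Y f g T x y t u t' u') : ∀ i ∈ used x t u t' u', f i ∉ Y := by
  rintro i (hi | hi)
  exacts [h.x_clean i hi, h.x_clean' i hi]

lemma clean_used' (h : IsLinkSquare X Y f g T x y t u t' u') : ∀ i ∈ used y t t' u u', g i ∉ X := by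
  rintro i (hi | hi)
  exacts [h.y_clean i hi, h.y_clean' i hi]

lemma disjoint_links (h : IsLinkSquare X Y f g T x y t u t' u')
    (L : IsLinkSystem G X Y f g n n' T x y Λ) :
    Disjoint (Λ t ∪ Λ u ∪ (Λ t' ∪ Λ u')) (X ∪ Y) := by
  rw [disjoint_union_left, disjoint_union_left, disjoint_union_left]
  exact ⟨⟨L.disj _ h.ht, L.disj _ h.hu⟩, L.disj _ h.ht', L.disj _ h.hu'⟩

lemma pathOn_g (h : IsLinkSquare X Y f g T x y t u t' u')
    (L : IsLinkSystem G X Y f g n n' T x y Λ) {lo hi : ℕ} (hhi : hi ≤ n')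
    (h1 : lo ≤ min (y t) (y t')) (h2 : max (y u) (y u') ≤ hi) :
    PathOn G (g lo) (g hi) (g '' (Icc lo hi \ removed y t t' u u') ∪
      (viaSet f x Λ t u ∪ viaSet f x Λ t' u')) := by
  have := h.y_lt
  exact L.track_g.reroute_two (by omega) (by omega) (by omega) (by omega) hhi
    (fun hc => h.ne_tt' (L.y_inj _ h.ht _ h.ht' hc))
    (fun hc => h.ne_uu' (L.y_inj _ h.hu _ h.hu' hc)) h.sign (by omega) (by omega) (by omega)
    (by omega) (L.swap.joinedVia h.ht h.hu h.ne_tu h.x_clean)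
    (L.swap.joinedVia h.ht' h.hu' h.ne_tu' h.x_clean')
    (L.swap.viaSet_disjoint_track h.ht h.hu h.x_clean)
    (L.swap.viaSet_disjoint_track h.ht' h.hu' h.x_clean')
    (L.swap.viaSet_disjoint_viaSet h.ht h.hu h.ht' h.hu' h.x_lt)

/-- If the orders agreed on `f` as they do on `g`, then `reroute_two` would apply to both tracks and
give a forbidden exchange. -/
lemma reversed [Finite W] (h : IsLinkSquare X Y f g T x y t u t' u')
    (L : IsLinkSystem G X Y f g n n' T x y Λ) : ¬ (x t < x u ↔ x t' < x u') := by
  intro hiff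
  have hlt := h.x_lt
  refine L.exchange_false (U := removed x t u t' u') (B := used x t u t' u')
    (U' := removed y t t' u u') (B' := used y t t' u u') (M := Λ t ∪ Λ u ∪ (Λ t' ∪ Λ u'))
    (b := x t) ?_ ?_ removed_subset_used removed_subset_used (h.le_of_mem_used L)
    h.clean_used h.clean_used' (h.disjoint_links L) (.inl left_mem_uIcc)
    h.notMem_removed
  · have hp := L.track_f.reroute_two (Nat.zero_le _) (Nat.zero_le _) (L.x_le _ h.ht')
      (L.x_le _ h.hu') le_rfl (fun hc => h.ne_tu (L.x_inj _ h.ht _ h.hu hc))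
      (fun hc => h.ne_tu' (L.x_inj _ h.ht' _ h.hu' hc)) hiff (by omega) (by omega) (by omega)
      (by omega) (L.joinedVia h.ht h.ht' h.ne_tt' h.y_clean)
      (L.joinedVia h.hu h.hu' h.ne_uu' h.y_clean')
      (L.viaSet_disjoint_track h.ht h.ht' h.y_clean)
      (L.viaSet_disjoint_track h.hu h.hu' h.y_clean')
      (L.viaSet_disjoint_viaSet h.ht h.ht' h.hu h.hu' h.y_lt)
    convert hp using 2
    · rfl
    simp only [viaSet, used, image_union]
    ac_rfl
  · convert h.pathOn_g L (lo := 0) le_rfl (Nat.zero_le _)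
      (max_le (L.y_le _ h.hu) (L.y_le _ h.hu')) using 2
    simp only [viaSet, used, image_union]
    ac_rfl

variable {v w v' w' : ι}

lemma pathOn_g_two (h : IsLinkSquare X Y f g T x y t u t' u') (k : IsLinkSquare X Y f g T x y v w v' w')
    (L : IsLinkSystem G X Y f g n n' T x y Λ)
    (hx₁ : max (x t) (x u) < min (x v) (x w)) (hx₂ : max (x v) (x w) < min (x t') (x u'))
    (hx₃ : max (x t') (x u') < min (x v') (x w')) (hy : max (y u) (y u') < min (y v) (y v') ∨
      max (y w) (y w') < min (y t) (y t')) :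
    PathOn G (g 0) (g n') (g '' (Icc 0 n' \ (removed y t t' u u' ∪ removed y v v' w w')) ∪
      (viaSet f x Λ t u ∪ viaSet f x Λ t' u' ∪ (viaSet f x Λ v w ∪ viaSet f x Λ v' w'))) := by
  have ht := L.y_le _ h.ht
  have hu := L.y_le _ h.hu
  have ht' := L.y_le _ h.ht'
  have hu' := L.y_le _ h.hu'
  have hv := L.y_le _ k.ht
  have hw := L.y_le _ k.hu
  have hv' := L.y_le _ k.ht'
  have hw' := L.y_le _ k.hu'
  have hylt := h.y_lt
  have kylt := k.y_lt
  have hxlt := h.x_lt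
  have kxlt := k.x_lt
  have d1 := L.swap.viaSet_disjoint_track h.ht h.hu h.x_clean
  have d2 := L.swap.viaSet_disjoint_track h.ht' h.hu' h.x_clean'
  have d3 := L.swap.viaSet_disjoint_track k.ht k.hu k.x_clean
  have d4 := L.swap.viaSet_disjoint_track k.ht' k.hu' k.x_clean'
  have e1 := L.swap.viaSet_disjoint_viaSet h.ht h.hu k.ht k.hu (by omega)
  have e2 := L.swap.viaSet_disjoint_viaSet h.ht h.hu k.ht' k.hu' (by omega)
  have e3 := L.swap.viaSet_disjoint_viaSet k.ht k.hu h.ht' h.hu' (by omega)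
  have e4 := L.swap.viaSet_disjoint_viaSet h.ht' h.hu' k.ht' k.hu' (by omega)
  have hJ : Disjoint (viaSet f x Λ t u ∪ viaSet f x Λ t' u')
      (viaSet f x Λ v w ∪ viaSet f x Λ v' w') := by
    rw [disjoint_union_left, disjoint_union_right, disjoint_union_right]
    exact ⟨⟨e1, e2⟩, e3.symm, e4⟩
  have hmem : ∀ {a b c d : ι} {i : ℕ}, i ∈ removed y a b c d →
      min (min (y a) (y b)) (min (y c) (y d)) < i ∧
        i < max (max (y a) (y b)) (max (y c) (y d)) := by
    intro a b c d i hi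
    simp only [removed, uIoo, mem_Ioo, mem_union] at hi
    omega
  rcases hy with hy | hy
  · set c := max (y u) (y u') with hc
    refine L.track_g.pathOn_append (c := c) (by omega)
      (h.pathOn_g L (by omega) (Nat.zero_le _) le_rfl)
      (k.pathOn_g L le_rfl (by omega) (by omega)) (fun i hi => ?_) (fun i hi => ?_)
      (disjoint_union_left.2 ⟨d1, d2⟩) (disjoint_union_left.2 ⟨d3, d4⟩) hJ
    · have := hmem hi
      omega
    · have := hmem hi
      omega
  · set c := max (y w) (y w') with hc
    rw [union_comm (removed y t t' u u'), union_comm (viaSet f x Λ t u ∪ viaSet f x Λ t' u')]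
    refine L.track_g.pathOn_append (c := c) (by omega)
      (k.pathOn_g L (by omega) (Nat.zero_le _) le_rfl)
      (h.pathOn_g L le_rfl (by omega) (by omega)) (fun i hi => ?_) (fun i hi => ?_)
      (disjoint_union_left.2 ⟨d3, d4⟩) (disjoint_union_left.2 ⟨d1, d2⟩) hJ.symm
    · have := hmem hi
      omega
    · have := hmem hi
      omega

/-- On `f` the squares interleave and are reversed, as `reroute_cross'` requires. On `g` they occupy
disjoint stretches and are rerouted one after the other. Together this is an exchange. -/
lemma cross_false [Finite W] (h : IsLinkSquare X Y f g T x y t u t' u')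
    (k : IsLinkSquare X Y f g T x y v w v' w') (L : IsLinkSystem G X Y f g n n' T x y Λ)
    (hx₁ : max (x t) (x u) < min (x v) (x w)) (hx₂ : max (x v) (x w) < min (x t') (x u'))
    (hx₃ : max (x t') (x u') < min (x v') (x w')) (hy : max (y u) (y u') < min (y v) (y v') ∨
      max (y w) (y w') < min (y t) (y t')) : False := by
  have hylt := h.y_lt
  have kylt := k.y_lt
  have aux : ∀ {a b c d : ι}, a ∈ T → b ∈ T → c ∈ T → d ∈ T →
      (max (y a) (y b) < min (y c) (y d) ∨ max (y c) (y d) < min (y a) (y b)) →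
      Disjoint (viaSet g y Λ a b) (viaSet g y Λ c d) := by
    rintro a b c d ha hb hc hd (hlt | hlt)
    · exact L.viaSet_disjoint_viaSet ha hb hc hd hlt
    · exact (L.viaSet_disjoint_viaSet hc hd ha hb hlt).symm
  refine L.exchange_false (U := removed x t u t' u' ∪ removed x v w v' w')
    (B := used x t u t' u' ∪ used x v w v' w')
    (U' := removed y t t' u u' ∪ removed y v v' w w')
    (B' := used y t t' u u' ∪ used y v v' w w')
    (M := Λ t ∪ Λ u ∪ (Λ t' ∪ Λ u') ∪ (Λ v ∪ Λ w ∪ (Λ v' ∪ Λ w')))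
    (b := x t) ?_ ?_ (union_subset_union removed_subset_used removed_subset_used)
    (union_subset_union removed_subset_used removed_subset_used)
    (fun i hi => hi.elim (h.le_of_mem_used L i) (k.le_of_mem_used L i))
    (fun i hi => hi.elim (h.clean_used i) (k.clean_used i))
    (fun i hi => hi.elim (h.clean_used' i) (k.clean_used' i))
    (disjoint_union_left.2 ⟨h.disjoint_links L, k.disjoint_links L⟩)
    (.inl (.inl left_mem_uIcc)) ?_
  · have hp := L.track_f.reroute_cross' (fun hc => h.ne_tu (L.x_inj _ h.ht _ h.hu hc))
      (fun hc => h.ne_tu' (L.x_inj _ h.ht' _ h.hu' hc)) (h.reversed L)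
      (fun hc => k.ne_tu (L.x_inj _ k.ht _ k.hu hc))
      (fun hc => k.ne_tu' (L.x_inj _ k.ht' _ k.hu' hc)) (k.reversed L) hx₁ hx₂ hx₃
      (max_le (L.x_le _ k.ht') (L.x_le _ k.hu'))
      (L.joinedVia h.ht h.ht' h.ne_tt' h.y_clean) (L.joinedVia h.hu h.hu' h.ne_uu' h.y_clean')
      (L.joinedVia k.ht k.ht' k.ne_tt' k.y_clean) (L.joinedVia k.hu k.hu' k.ne_uu' k.y_clean')
      (L.viaSet_disjoint_track h.ht h.ht' h.y_clean)
      (L.viaSet_disjoint_track h.hu h.hu' h.y_clean')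
      (L.viaSet_disjoint_track k.ht k.ht' k.y_clean)
      (L.viaSet_disjoint_track k.hu k.hu' k.y_clean')
      (aux h.ht h.ht' h.hu h.hu' (by omega)) (aux h.ht h.ht' k.ht k.ht' (by omega))
      (aux h.ht h.ht' k.hu k.hu' (by omega)) (aux h.hu h.hu' k.ht k.ht' (by omega))
      (aux h.hu h.hu' k.hu k.hu' (by omega)) (aux k.ht k.ht' k.hu k.hu' (by omega))
    convert hp using 2
    · rfl
    simp only [viaSet, used, image_union]
    ac_rfl
  · convert h.pathOn_g_two k L hx₁ hx₂ hx₃ hy using 2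
    simp only [viaSet, used, image_union]
    ac_rfl
  · rintro (hc | hc)
    · exact h.notMem_removed hc
    · simp only [removed, uIoo, mem_union, mem_Ioo] at hc
      omega

end IsLinkSquare

/-! ### Counting in ordered bipartite graphs -/

lemma exists_crossing_pairs {s : ℕ} {D : Finset (ℕ × ℕ)} (hD : ∀ p ∈ D, p.1 < p.2 ∧ p.2 < s)
    (hs : 2 * s < D.card) :
    ∃ i k j l, i < k ∧ k < j ∧ j < l ∧ (i, j) ∈ D ∧ (k, l) ∈ D := by
  classical
  -- Discard for each left end the longest pair and for each right end the longest pair, at most `2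
  -- * s` in all. A surviving pair can be prolonged to the right and to the left, and the two
  -- prolongations cross.
  set A := D.filter fun p => ∀ q ∈ D, q.1 = p.1 → q.2 ≤ p.2 with hA
  set B := D.filter fun p => ∀ q ∈ D, q.2 = p.2 → p.1 ≤ q.1 with hB
  have hAs : A.card ≤ s := by
    rw [← Finset.card_range s]
    refine Finset.card_le_card_of_injOn Prod.fst (fun p hp => ?_) (fun p hp q hq h => ?_)
    · have := hD p (Finset.mem_filter.1 hp).1
      simp only [Finset.coe_range, mem_Iio]
      omega
    · obtain ⟨hp1, hp2⟩ := Finset.mem_filter.1 hp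
      obtain ⟨hq1, hq2⟩ := Finset.mem_filter.1 hq
      exact Prod.ext h (le_antisymm (hq2 p hp1 h) (hp2 q hq1 h.symm))
  have hBs : B.card ≤ s := by
    rw [← Finset.card_range s]
    refine Finset.card_le_card_of_injOn Prod.snd (fun p hp => ?_) (fun p hp q hq h => ?_)
    · have := hD p (Finset.mem_filter.1 hp).1
      simp only [Finset.coe_range, mem_Iio]
      omega
    · obtain ⟨hp1, hp2⟩ := Finset.mem_filter.1 hp
      obtain ⟨hq1, hq2⟩ := Finset.mem_filter.1 hq
      exact Prod.ext (le_antisymm (hp2 q hq1 h.symm) (hq2 p hp1 h)) h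
  have hlt : (A ∪ B).card < D.card := (Finset.card_union_le A B).trans_lt (by omega)
  obtain ⟨p, hpD, hp⟩ := Finset.exists_mem_notMem_of_card_lt_card hlt
  simp only [hA, hB, Finset.mem_union, Finset.mem_filter, hpD, true_and, not_or] at hp
  push Not at hp
  obtain ⟨⟨q, hq, hq1, hq2⟩, ⟨r, hr, hr1, hr2⟩⟩ := hp
  refine ⟨r.1, p.1, p.2, q.2, hr2, (hD p hpD).1, hq2, ?_, ?_⟩
  · rw [← hr1]
    exact hr
  · rw [← hq1]
    exact hq

/-- The common neighbours below `s` of `i` and `j` in the bipartite graph with edge set `E`. -/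
def commonNeighbors (s : ℕ) (E : Finset (ℕ × ℕ)) (i j : ℕ) : Finset ℕ :=
  (Finset.range s).filter fun q => (i, q) ∈ E ∧ (j, q) ∈ E

/-- Without such a crossing, at most `2 * s` pairs have eight common neighbours, which makes the sum
of the squared degrees small; Cauchy–Schwarz then bounds the number of edges. -/
lemma exists_crossing_commonNeighbors {s : ℕ} {E : Finset (ℕ × ℕ)}
    (hE : ∀ p ∈ E, p.1 < s ∧ p.2 < s) (hs : 12 * s ^ 3 < E.card ^ 2) :
    ∃ i k j l, i < k ∧ k < j ∧ j < l ∧ 8 ≤ (commonNeighbors s E i j).card ∧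
      8 ≤ (commonNeighbors s E k l).card := by
  classical
  set D := ((Finset.range s) ×ˢ (Finset.range s)).filter fun p =>
    p.1 < p.2 ∧ 8 ≤ (commonNeighbors s E p.1 p.2).card with hDdef
  by_contra! hc
  have hD : D.card ≤ 2 * s := by
    by_contra! hlt
    obtain ⟨i, k, j, l, h1, h2, h3, h4, h5⟩ := exists_crossing_pairs (D := D) (s := s)
      (fun p hp => by
        simp only [hDdef, Finset.mem_filter, Finset.mem_product, Finset.mem_range] at hp
        exact ⟨hp.2.1, hp.1.2⟩) hlt
    simp only [hDdef, Finset.mem_filter] at h4 h5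
    have := hc i k j l h1 h2 h3 h4.2.2
    omega
  let e : ℕ → ℕ → ℕ := fun i q => if (i, q) ∈ E then 1 else 0
  have hcard : E.card = ∑ q ∈ Finset.range s, ∑ i ∈ Finset.range s, e i q := by
    rw [Finset.sum_comm, ← Finset.sum_product', Finset.sum_ite_mem, Finset.sum_const, smul_eq_mul,
      mul_one]
    congr 1
    refine (Finset.inter_eq_right.2 fun p hp => ?_).symm
    simpa using hE p hp
  have hco : ∀ i j, ∑ q ∈ Finset.range s, e i q * e j q = (commonNeighbors s E i j).card := by
    intro i j
    rw [commonNeighbors, Finset.card_filter]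
    refine Finset.sum_congr rfl fun q _ => ?_
    by_cases h1 : (i, q) ∈ E <;> by_cases h2 : (j, q) ∈ E <;> simp [e, h1, h2]
  have hbound : ∀ i ∈ Finset.range s, ∀ j ∈ Finset.range s, (commonNeighbors s E i j).card ≤
      7 + (if i = j then s else 0) + (if (i, j) ∈ D then s else 0) +
        (if (j, i) ∈ D then s else 0) := by
    intro i hi j hj
    have hle : (commonNeighbors s E i j).card ≤ s :=
      (Finset.card_filter_le _ _).trans (Finset.card_range s).le
    by_cases h8 : (commonNeighbors s E i j).card ≤ 7
    · omega
    rcases lt_trichotomy i j with hij | hij | hij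
    · have : (i, j) ∈ D := by
        simp only [hDdef, Finset.mem_filter, Finset.mem_product]
        exact ⟨⟨hi, hj⟩, hij, by omega⟩
      rw [if_pos this]
      omega
    · rw [if_pos hij]
      omega
    · have : (j, i) ∈ D := by
        simp only [hDdef, Finset.mem_filter, Finset.mem_product]
        refine ⟨⟨hj, hi⟩, hij, ?_⟩
        have hsymm : commonNeighbors s E j i = commonNeighbors s E i j := by
          simp only [commonNeighbors, and_comm]
        rw [hsymm]
        omega
      rw [if_pos this]
      omega
  have hDsum : ∑ i ∈ Finset.range s, ∑ j ∈ Finset.range s, (if (i, j) ∈ D then s else 0) ≤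
      D.card * s := by
    rw [← Finset.sum_product', Finset.sum_ite_mem, Finset.sum_const, smul_eq_mul]
    exact Nat.mul_le_mul_right _ (Finset.card_le_card Finset.inter_subset_right)
  have hDsum' : ∑ i ∈ Finset.range s, ∑ j ∈ Finset.range s, (if (j, i) ∈ D then s else 0) ≤
      D.card * s := by
    rw [Finset.sum_comm]
    exact hDsum
  -- The sum counts common neighbours over ordered pairs. The constant is `7` for all pairs, `1` for
  -- the diagonal and `2 · 2` for the pairs in `D` in both orders.
  have hsum : ∑ q ∈ Finset.range s, (∑ i ∈ Finset.range s, e i q) ^ 2 ≤ 12 * s ^ 2 := by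
    calc ∑ q ∈ Finset.range s, (∑ i ∈ Finset.range s, e i q) ^ 2
        = ∑ i ∈ Finset.range s, ∑ j ∈ Finset.range s, ∑ q ∈ Finset.range s, e i q * e j q := by
          simp_rw [sq, Finset.sum_mul_sum]
          rw [Finset.sum_comm]
          refine Finset.sum_congr rfl fun i _ => ?_
          rw [Finset.sum_comm]
      _ ≤ ∑ i ∈ Finset.range s, ∑ j ∈ Finset.range s, (7 + (if i = j then s else 0) +
            (if (i, j) ∈ D then s else 0) + (if (j, i) ∈ D then s else 0)) := by
          refine Finset.sum_le_sum fun i hi => Finset.sum_le_sum fun j hj => ?_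
          rw [hco]
          exact hbound i hi j hj
      _ ≤ 7 * s ^ 2 + s ^ 2 + D.card * s + D.card * s := by
          simp only [Finset.sum_add_distrib]
          refine add_le_add (add_le_add (add_le_add ?_ ?_) hDsum) hDsum'
          · simp only [Finset.sum_const, Finset.card_range, smul_eq_mul]
            exact le_of_eq (by ring)
          · refine (Finset.sum_le_sum (g := fun _ => s) fun i hi => ?_).trans ?_
            · rw [Finset.sum_ite_eq, if_pos hi]
            · simp [sq]
      _ ≤ 12 * s ^ 2 := by nlinarith
  have hcs := sq_sum_le_card_mul_sum_sq (s := Finset.range s)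
    (f := fun q => ∑ i ∈ Finset.range s, e i q)
  rw [← hcard, Finset.card_range] at hcs
  have : s * ∑ q ∈ Finset.range s, (∑ i ∈ Finset.range s, e i q) ^ 2 ≤ s * (12 * s ^ 2) :=
    Nat.mul_le_mul_left _ hsum
  nlinarith

lemma exists_lt_iff {A : Finset ℕ} (hA : 3 ≤ A.card) (σ : ℕ → Prop) :
    ∃ a ∈ A, ∃ b ∈ A, a < b ∧ (σ a ↔ σ b) := by
  obtain ⟨a, ha, b, hb, c, hc, hab, hac, hbc⟩ := Finset.two_lt_card.1 hA
  have aux : ∀ {u v}, u ∈ A → v ∈ A → u ≠ v → (σ u ↔ σ v) →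
      ∃ a ∈ A, ∃ b ∈ A, a < b ∧ (σ a ↔ σ b) := by
    intro u v hu hv huv h
    rcases lt_or_gt_of_ne huv with hlt | hlt
    · exact ⟨u, hu, v, hv, hlt, h⟩
    · exact ⟨v, hv, u, hu, hlt, h.symm⟩
  by_cases h1 : σ a ↔ σ b
  · exact aux ha hb hab h1
  by_cases h2 : σ a ↔ σ c
  · exact aux ha hc hac h2
  exact aux hb hc hbc (by tauto)

/-- Cut at the first place before which one of the sets has three elements; the other still has at
least five elements after it. Among three elements two have the same sign. -/
lemma exists_separated_pairs {A B : Finset ℕ} (hA : 8 ≤ A.card) (hB : 8 ≤ B.card)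
    (σ τ : ℕ → Prop) : ∃ a ∈ A, ∃ a' ∈ A, ∃ b ∈ B, ∃ b' ∈ B, a < a' ∧ b < b' ∧ (σ a ↔ σ a') ∧
      (τ b ↔ τ b') ∧ (a' < b ∨ b' < a) := by
  classical
  have hlow : ∀ (C : Finset ℕ) (c : ℕ),
      (C.filter (· < c + 1)).card ≤ (C.filter (· < c)).card + 1 := by
    intro C c
    refine (Finset.card_le_card (t := insert c (C.filter (· < c))) fun i hi => ?_).trans
      (Finset.card_insert_le _ _)
    simp only [Finset.mem_filter, Finset.mem_insert] at hi ⊢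
    have := hi.1
    rcases Nat.lt_succ_iff_lt_or_eq.1 hi.2 with h | h
    · exact .inr ⟨this, h⟩
    · exact .inl h
  have hsplit : ∀ (C : Finset ℕ) (c : ℕ),
      (C.filter (· < c)).card + (C.filter fun i => ¬ i < c).card = C.card := fun C c =>
    Finset.card_filter_add_card_filter_not _
  have hex : ∃ c, 3 ≤ (A.filter (· < c)).card ∨ 3 ≤ (B.filter (· < c)).card := by
    refine ⟨A.sup id + 1, .inl ?_⟩
    rw [Finset.filter_true_of_mem]
    · omega
    · intro i hi
      exact Nat.lt_succ_of_le (Finset.le_sup (f := id) hi)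
  obtain ⟨c, hc, hmin⟩ : ∃ c, (3 ≤ (A.filter (· < c)).card ∨ 3 ≤ (B.filter (· < c)).card) ∧
      ∀ d < c, ¬ (3 ≤ (A.filter (· < d)).card ∨ 3 ≤ (B.filter (· < d)).card) :=
    ⟨Nat.find hex, Nat.find_spec hex, fun d hd => Nat.find_min hex hd⟩
  obtain ⟨d, rfl⟩ : ∃ d, c = d + 1 := by
    rcases c with _ | d
    · simp at hc
    · exact ⟨d, rfl⟩
  have h1 := hmin d (Nat.lt_succ_self d)
  have hA1 := hlow A d
  have hB1 := hlow B d
  have hA2 := hsplit A (d + 1)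
  have hB2 := hsplit B (d + 1)
  rcases hc with hc | hc
  · obtain ⟨a, ha, a', ha', hlt, hσ⟩ := exists_lt_iff hc σ
    obtain ⟨b, hb, b', hb', hlt', hτ⟩ := exists_lt_iff
      (A := B.filter fun i => ¬ i < d + 1) (by omega) τ
    rw [Finset.mem_filter] at ha ha' hb hb'
    exact ⟨a, ha.1, a', ha'.1, b, hb.1, b', hb'.1, hlt, hlt', hσ, hτ, .inl (by omega)⟩
  · obtain ⟨b, hb, b', hb', hlt', hτ⟩ := exists_lt_iff hc τ
    obtain ⟨a, ha, a', ha', hlt, hσ⟩ := exists_lt_iff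
      (A := A.filter fun i => ¬ i < d + 1) (by omega) σ
    rw [Finset.mem_filter] at ha ha' hb hb'
    exact ⟨a, ha.1, a', ha'.1, b, hb.1, b', hb'.1, hlt, hlt', hσ, hτ, .inr (by omega)⟩

/-! ### Clean segments of a track and the bound for one pair of tracks -/

open Classical in
/-- The number of positions before `i` at which the track `f` meets `Y`. -/
noncomputable def hitsBefore {W : Type*} (f : ℕ → W) (Y : Set W) (i : ℕ) : ℕ :=
  ((Finset.range i).filter fun k => f k ∈ Y).card

section hitsBefore

variable {W : Type*} {f : ℕ → W} {X Y : Set W} {i j n : ℕ}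

lemma hitsBefore_mono (hij : i ≤ j) : hitsBefore f Y i ≤ hitsBefore f Y j := by
  classical
  exact Finset.card_le_card (Finset.filter_subset_filter _ (Finset.range_mono hij))

lemma lt_of_hitsBefore_lt (h : hitsBefore f Y i < hitsBefore f Y j) : i < j := by
  by_contra! hc
  exact absurd (hitsBefore_mono (f := f) (Y := Y) hc) (by omega)

/-- For positions off `Y`, `hitsBefore` is thus the index of the segment into which `Y` cuts the
track. -/
lemma cleanOn_of_hitsBefore_eq (h : hitsBefore f Y i = hitsBefore f Y j) (hi : f i ∉ Y)
    (hj : f j ∉ Y) : CleanOn f Y i j := by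
  classical
  wlog hij : i ≤ j generalizing i j
  · intro k hk
    rw [uIcc_comm] at hk
    exact this h.symm hj hi (by omega) k hk
  intro k hk hkY
  rw [uIcc_of_le hij] at hk
  have hki : i ≤ k := hk.1
  have hkj : k < j := lt_of_le_of_ne hk.2 (by rintro rfl; exact hj hkY)
  have : hitsBefore f Y i < hitsBefore f Y j := by
    refine Finset.card_lt_card ⟨Finset.filter_subset_filter _ (Finset.range_mono hij), fun hc => ?_⟩
    have := hc (x := k) (by simp [hkj, hkY])
    simp only [Finset.mem_filter, Finset.mem_range] at this
    omega
  omega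

lemma hitsBefore_le [Finite W] {G : SimpleGraph W} (hf : IsTrack G f n) (hX : ∀ k ≤ n, f k ∈ X)
    (hi : i ≤ n) : hitsBefore f Y i ≤ (X ∩ Y).ncard := by
  classical
  rw [hitsBefore, ← Set.ncard_coe_finset]
  refine Set.ncard_le_ncard_of_injOn f (fun k hk => ?_) (fun k hk l hl h => ?_)
  · simp only [Finset.coe_filter, Finset.mem_range, mem_ofPred_eq] at hk
    exact ⟨hX k (by omega), hk.2⟩
  · simp only [Finset.coe_filter, Finset.mem_range, mem_ofPred_eq] at hk hl
    exact hf.inj k (by omega) l (by omega) h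

end hitsBefore

lemma IsLinkSystem.card_sq_le {W ι : Type*} [Finite W] {G : SimpleGraph W} {X Y : Set W}
    {f g : ℕ → W} {n n' : ℕ} {T : Finset ι} {x y : ι → ℕ} {Λ : ι → Set W}
    (L : IsLinkSystem G X Y f g n n' T x y Λ) :
    T.card ^ 2 ≤ 12 * ((X ∩ Y).ncard + 1) ^ 3 := by
  classical
  set s := (X ∩ Y).ncard + 1 with hs
  by_contra! hlt
  let a : ι → ℕ := fun t => hitsBefore f Y (x t)
  let b : ι → ℕ := fun t => hitsBefore g X (y t)
  have hxc : ∀ t ∈ T, ∀ u ∈ T, a t = a u → CleanOn f Y (x t) (x u) := fun t ht u hu h =>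
    cleanOn_of_hitsBefore_eq h (L.x_notMem t ht) (L.x_notMem u hu)
  have hyc : ∀ t ∈ T, ∀ u ∈ T, b t = b u → CleanOn g X (y t) (y u) := fun t ht u hu h =>
    cleanOn_of_hitsBefore_eq h (L.y_notMem t ht) (L.y_notMem u hu)
  have hxlt : ∀ {t u}, a t < a u → x t < x u := fun h => lt_of_hitsBefore_lt h
  have hylt : ∀ {t u}, b t < b u → y t < y u := fun h => lt_of_hitsBefore_lt h
  set E := T.image fun t => (a t, b t) with hE
  have hEcard : E.card = T.card := by
    refine Finset.card_image_of_injOn fun t ht u hu h => ?_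
    simp only [Prod.mk.injEq] at h
    exact L.eq_of_clean ht hu (hxc t ht u hu h.1) (hyc t ht u hu h.2)
  have hEs : ∀ p ∈ E, p.1 < s ∧ p.2 < s := by
    intro p hp
    obtain ⟨t, ht, rfl⟩ := Finset.mem_image.1 hp
    constructor
    · exact Nat.lt_succ_of_le (hitsBefore_le L.track_f L.f_mem (L.x_le t ht))
    · refine Nat.lt_succ_of_le ?_
      rw [inter_comm]
      exact hitsBefore_le L.track_g L.g_mem (L.y_le t ht)
  obtain ⟨i, k, j, l, hik, hkj, hjl, hij8, hkl8⟩ :=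
    exists_crossing_commonNeighbors hEs (by rw [hEcard]; exact hlt)
  -- A link is chosen for every edge. Pairs outside `E` get an arbitrary link, which exists because
  -- `T` is large.
  have hex : ∀ p : ℕ × ℕ, ∃ t, p ∈ E → t ∈ T ∧ a t = p.1 ∧ b t = p.2 := by
    intro p
    by_cases hp : p ∈ E
    · obtain ⟨t, ht, rfl⟩ := Finset.mem_image.1 hp
      exact ⟨t, fun _ => ⟨ht, rfl, rfl⟩⟩
    · have : T.card ≠ 0 := by
        intro h0
        simp [h0] at hlt
      obtain ⟨t, -⟩ := Finset.card_pos.1 (Nat.pos_of_ne_zero this)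
      exact ⟨t, fun h => (hp h).elim⟩
  choose τ hτ using hex
  -- The sign of a common neighbour `q` is the order, on the segment `q` of `g`, of the two links
  -- that arrive there.
  obtain ⟨q₁, hq₁, q₂, hq₂, q₃, hq₃, q₄, hq₄, h12, h34, hσ, hσ', hsep⟩ :=
    exists_separated_pairs hij8 hkl8 (fun q => y (τ (i, q)) < y (τ (j, q)))
      (fun q => y (τ (k, q)) < y (τ (l, q)))
  simp only [commonNeighbors, Finset.mem_filter] at hq₁ hq₂ hq₃ hq₄
  have hsq : ∀ {i j q q' : ℕ}, i < j → q < q' → ((i, q) ∈ E ∧ (j, q) ∈ E) →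
      ((i, q') ∈ E ∧ (j, q') ∈ E) →
      (y (τ (i, q)) < y (τ (j, q)) ↔ y (τ (i, q')) < y (τ (j, q'))) →
      IsLinkSquare X Y f g (T : Set ι) x y (τ (i, q)) (τ (i, q')) (τ (j, q)) (τ (j, q')) := by
    intro i j q q' hij hqq h h' hsign
    obtain ⟨m1, a1, b1⟩ := hτ _ h.1
    obtain ⟨m2, a2, b2⟩ := hτ _ h.2
    obtain ⟨m3, a3, b3⟩ := hτ _ h'.1
    obtain ⟨m4, a4, b4⟩ := hτ _ h'.2
    exact ⟨m1, m3, m2, m4,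
      max_lt (lt_min (hxlt (by omega)) (hxlt (by omega)))
        (lt_min (hxlt (by omega)) (hxlt (by omega))),
      max_lt (lt_min (hylt (by omega)) (hylt (by omega)))
        (lt_min (hylt (by omega)) (hylt (by omega))),
      hxc _ m1 _ m3 (by omega), hxc _ m2 _ m4 (by omega),
      hyc _ m1 _ m2 (by omega), hyc _ m3 _ m4 (by omega), hsign⟩
  have S := hsq (hik.trans hkj) h12 hq₁.2 hq₂.2 hσ
  have S' := hsq (hkj.trans hjl) h34 hq₃.2 hq₄.2 hσ'
  obtain ⟨-, a1, b1⟩ := hτ _ hq₁.2.1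
  obtain ⟨-, a2, b2⟩ := hτ _ hq₁.2.2
  obtain ⟨-, a3, b3⟩ := hτ _ hq₂.2.1
  obtain ⟨-, a4, b4⟩ := hτ _ hq₂.2.2
  obtain ⟨-, a5, b5⟩ := hτ _ hq₃.2.1
  obtain ⟨-, a6, b6⟩ := hτ _ hq₃.2.2
  obtain ⟨-, a7, b7⟩ := hτ _ hq₄.2.1
  obtain ⟨-, a8, b8⟩ := hτ _ hq₄.2.2
  refine S.cross_false S' L
    (max_lt (lt_min (hxlt (by omega)) (hxlt (by omega)))
      (lt_min (hxlt (by omega)) (hxlt (by omega))))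
    (max_lt (lt_min (hxlt (by omega)) (hxlt (by omega)))
      (lt_min (hxlt (by omega)) (hxlt (by omega))))
    (max_lt (lt_min (hxlt (by omega)) (hxlt (by omega)))
      (lt_min (hxlt (by omega)) (hxlt (by omega)))) (hsep.imp (fun h => ?_) (fun h => ?_))
  · exact max_lt (lt_min (hylt (by omega)) (hylt (by omega)))
      (lt_min (hylt (by omega)) (hylt (by omega)))
  · exact max_lt (lt_min (hylt (by omega)) (hylt (by omega)))
      (lt_min (hylt (by omega)) (hylt (by omega)))

/-! ### Replacing the interior of a subdivided edge -/

section Walks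

variable {W : Type*} {G : SimpleGraph W}

lemma SimpleGraph.Walk.IsPath.exists_pathOn_dropLast {w v : W} {q : G.Walk w v} (hq : q.IsPath)
    (hwv : w ≠ v) : ∃ t S, PathOn G w t S ∧ G.Adj t v ∧ v ∉ S ∧
      {z | z ∈ q.support} = insert v S ∧ s(t, v) ∈ q.edges := by
  have hr := hq.reverse
  have hs : ∀ z, z ∈ q.support ↔ z ∈ q.reverse.support := by simp
  have he : ∀ z, z ∈ q.edges ↔ z ∈ q.reverse.edges := by simp
  simp only [hs, he]
  revert hr
  cases q.reverse with
  | nil => exact (hwv rfl).elim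
  | cons h r =>
    intro hr
    rw [SimpleGraph.Walk.cons_isPath_iff] at hr
    rename_i t
    refine ⟨t, {z | z ∈ r.support}, PathOn.symm ⟨r, hr.1, rfl⟩, h.symm, hr.2, ?_, ?_⟩
    · ext z
      simp
    · simp [Sym2.eq_swap]

lemma SimpleGraph.Walk.IsPath.exists_interior {u v : W} {p : G.Walk u v} (hp : p.IsPath)
    (huv : u ≠ v) : ∃ S, p.toSubgraph.verts = {u, v} ∪ S ∧ u ∉ S ∧ v ∉ S ∧
      (S = ∅ ∨ ∃ s t, PathOn G s t S ∧ G.Adj u s ∧ G.Adj t v ∧ (u = v → s ≠ t)) := by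
  cases p with
  | nil => exact (huv rfl).elim
  | cons h q =>
    rw [SimpleGraph.Walk.cons_isPath_iff] at hp
    rename_i w
    rcases eq_or_ne w v with rfl | hwv
    · have hnil := (SimpleGraph.Walk.isPath_iff_nil.1 hp.1).eq_nil
      subst hnil
      refine ⟨∅, ?_, by simp, by simp, .inl rfl⟩
      ext z
      simp
    · obtain ⟨t, S, hS, htv, hv, hsup, -⟩ := hp.1.exists_pathOn_dropLast hwv
      have hm : ∀ z, z ∈ q.support ↔ z = v ∨ z ∈ S := fun z => by
        have := Set.ext_iff.1 hsup z
        simpa using this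
      refine ⟨S, ?_, fun hu => hp.2 ((hm u).2 (.inr hu)), hv, .inr ⟨w, t, hS, h, htv,
        fun h => (huv h).elim⟩⟩
      have hw := hS.left_mem
      ext z
      simp only [SimpleGraph.Walk.verts_toSubgraph, SimpleGraph.Walk.support_cons, List.mem_cons,
        hm, mem_ofPred_eq, mem_union, mem_insert_iff, mem_singleton_iff, or_assoc]

lemma SimpleGraph.Walk.IsCycle.exists_interior {u : W} {p : G.Walk u u} (hp : p.IsCycle) :
    ∃ S, p.toSubgraph.verts = {u, u} ∪ S ∧ u ∉ S ∧ u ∉ S ∧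
      (S = ∅ ∨ ∃ s t, PathOn G s t S ∧ G.Adj u s ∧ G.Adj t u ∧ (u = u → s ≠ t)) := by
  cases p with
  | nil => exact (hp.not_nil .nil).elim
  | cons h q =>
    rw [SimpleGraph.Walk.cons_isCycle_iff] at hp
    rename_i w
    obtain ⟨t, S, hS, htv, hv, hsup, hedge⟩ := hp.1.exists_pathOn_dropLast h.ne'
    have hm : ∀ z, z ∈ q.support ↔ z = u ∨ z ∈ S := fun z => by
      have := Set.ext_iff.1 hsup z
      simpa using this
    refine ⟨S, ?_, hv, hv, .inr ⟨w, t, hS, h, htv, fun _ hwt => hp.2 ?_⟩⟩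
    · ext z
      simp only [SimpleGraph.Walk.verts_toSubgraph, SimpleGraph.Walk.support_cons, List.mem_cons,
        hm, mem_ofPred_eq, mem_union, mem_insert_iff, mem_singleton_iff]
      tauto
    · have hwt' : s(u, w) = s(t, u) := by rw [hwt, Sym2.eq_swap]
      rw [hwt']
      exact hedge

/-- Paths and cycles are treated together. For `u = v` the condition `s ≠ t` keeps the closed walk
from using one edge back and forth. Since every edge has an end in `S`, edge-disjointness will
follow from vertex-disjointness of interiors. -/
lemma PathOn.exists_walk_of_adj {u v s t : W} {S : Set W} (h : PathOn G s t S) (hus : G.Adj u s)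
    (htv : G.Adj t v) (hu : u ∉ S) (hv : v ∉ S) (hst : u = v → s ≠ t) :
    ∃ p : G.Walk u v, (u ≠ v → p.IsPath) ∧ (∀ huv : v = u, (p.copy rfl huv).IsCycle) ∧
      p.toSubgraph.verts = {u, v} ∪ S ∧ ∀ a b, p.toSubgraph.Adj a b → a ∈ S ∨ b ∈ S := by
  obtain ⟨r, hr, rfl⟩ := h
  have hc : (r.concat htv).IsPath := hr.concat hv htv
  refine ⟨.cons hus (r.concat htv), fun huv => ?_, ?_, ?_, ?_⟩
  · rw [SimpleGraph.Walk.cons_isPath_iff]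
    refine ⟨hc, ?_⟩
    simp only [SimpleGraph.Walk.support_concat, List.mem_append, List.mem_singleton, not_or]
    exact ⟨hu, huv⟩
  · rintro rfl
    rw [SimpleGraph.Walk.copy_rfl_rfl, SimpleGraph.Walk.cons_isCycle_iff]
    refine ⟨hc, ?_⟩
    simp only [SimpleGraph.Walk.edges_concat, List.concat_eq_append, List.mem_append, List.mem_singleton, not_or]
    refine ⟨fun he => hu (r.fst_mem_support_of_mem_edges he), fun he => ?_⟩
    rw [Sym2.eq_iff] at he
    rcases he with ⟨h1, h2⟩ | ⟨-, h2⟩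
    · exact htv.ne h1.symm
    · exact hst rfl h2
  · ext z
    simp only [SimpleGraph.Walk.verts_toSubgraph, SimpleGraph.Walk.support_cons,
      SimpleGraph.Walk.support_concat, List.mem_cons, List.mem_append, mem_union,
      mem_insert_iff, mem_singleton_iff, mem_ofPred_eq, List.not_mem_nil, or_false]
    tauto
  · intro a b hab
    rw [SimpleGraph.Walk.adj_toSubgraph_iff_mem_edges] at hab
    simp only [SimpleGraph.Walk.edges_cons, SimpleGraph.Walk.edges_concat, List.mem_cons,
      List.concat_eq_append, List.mem_append, List.not_mem_nil, or_false] at hab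
    rcases hab with hab | hab | hab
    · rcases Sym2.eq_iff.1 hab with ⟨-, rfl⟩ | ⟨rfl, -⟩
      · exact .inr r.start_mem_support
      · exact .inl r.start_mem_support
    · exact .inl (r.fst_mem_support_of_mem_edges hab)
    · rcases Sym2.eq_iff.1 hab with ⟨rfl, -⟩ | ⟨-, rfl⟩
      · exact .inl r.end_mem_support
      · exact .inr r.end_mem_support

end Walks

namespace IsSubdivisionModel

variable {α β W : Type*} {G : SimpleGraph W} {R : Graph α β} {H : G.Subgraph} {φ : α → W}
  {P : β → G.Subgraph} {e : β} {x y : α}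

lemma exists_interior (h : IsSubdivisionModel R H φ P) (hl : R.IsLink e x y) :
    ∃ S, (P e).verts = {φ x, φ y} ∪ S ∧ φ x ∉ S ∧ φ y ∉ S ∧
      (S = ∅ ∨ ∃ s t, PathOn G s t S ∧ G.Adj (φ x) s ∧ G.Adj t (φ y) ∧ (x = y → s ≠ t)) := by
  rcases eq_or_ne x y with rfl | hxy
  · obtain ⟨c, hc, hcP⟩ := h.isCycle e x hl
    obtain ⟨S, h1, h2, h3, h4⟩ := hc.exists_interior
    refine ⟨S, hcP ▸ h1, h2, h3, h4.imp_right ?_⟩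
    rintro ⟨s, t, h5, h6, h7, h8⟩
    exact ⟨s, t, h5, h6, h7, fun _ => h8 rfl⟩
  · obtain ⟨p, hp, hpP⟩ := h.isPath e x y hl hxy
    have hne : φ x ≠ φ y := fun hc => hxy (h.branch_injOn hl.left_mem hl.right_mem hc)
    obtain ⟨S, h1, h2, h3, h4⟩ := hp.exists_interior hne
    refine ⟨S, hpP ▸ h1, h2, h3, h4.imp_right ?_⟩
    rintro ⟨s, t, h5, h6, h7, h8⟩
    exact ⟨s, t, h5, h6, h7, fun hc => (hxy hc).elim⟩

/-- The interior `S` contains no branch vertex and meets no other subdivided edge, and `S'` meets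
`H` only inside `S`. So the new interior can take the place of the old one, all else remaining
fixed. -/
lemma exists_replace (h : IsSubdivisionModel R H φ P) (hl : R.IsLink e x y) {S S' : Set W}
    {s t : W} (hS : (P e).verts = {φ x, φ y} ∪ S) (hxS : φ x ∉ S) (hyS : φ y ∉ S)
    (hs : G.Adj (φ x) s) (ht : G.Adj t (φ y)) (hst : x = y → s ≠ t) (hS' : PathOn G s t S')
    (hd : Disjoint S' (H.verts \ S)) :
    ∃ K : G.Subgraph, IsSubdivision R K ∧ K.verts = (H.verts \ S) ∪ S' := by
  classical
  have heR : e ∈ R.edgeSet := hl.edge_mem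
  have hPH : ∀ f ∈ R.edgeSet, (P f).verts ⊆ H.verts := by
    intro f hf
    rw [h.verts_eq]
    exact (subset_biUnion_of_mem (u := fun f => (P f).verts) hf).trans subset_union_right
  have hVH : φ '' R.vertexSet ⊆ H.verts := by
    rw [h.verts_eq]
    exact subset_union_left
  have hincS : ∀ z, R.Inc e z → φ z ∉ S := by
    intro z hz
    rcases hz.eq_or_eq_of_isLink hl with rfl | rfl
    exacts [hxS, hyS]
  have hSP : S ⊆ (P e).verts := hS ▸ subset_union_right
  have hVS : ∀ z ∈ R.vertexSet, φ z ∉ S := fun z hz hzS =>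
    hincS z (h.branch_mem e heR z hz (hSP hzS)) hzS
  have hfS : ∀ f ∈ R.edgeSet, f ≠ e → ∀ w ∈ (P f).verts, w ∉ S := by
    intro f hf hfe w hw hwS
    obtain ⟨z, -, hz, rfl⟩ := h.internally_disjoint f hf e heR hfe w ⟨hw, hSP hwS⟩
    exact hincS z hz hwS
  have hS'H : ∀ w ∈ S', w ∈ H.verts → w ∈ S := by
    intro w hw hwH
    by_contra hwS
    exact hd.le_bot ⟨hw, hwH, hwS⟩
  have hVS' : ∀ z ∈ R.vertexSet, φ z ∉ S' := fun z hz hzS =>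
    hVS z hz (hS'H _ hzS (hVH ⟨z, hz, rfl⟩))
  have hfS' : ∀ f ∈ R.edgeSet, f ≠ e → ∀ w ∈ (P f).verts, w ∉ S' := fun f hf hfe w hw hwS =>
    hfS f hf hfe w hw (hS'H w hwS (hPH f hf hw))
  have hφ : φ x = φ y → x = y := fun hc => h.branch_injOn hl.left_mem hl.right_mem hc
  obtain ⟨q, hqpath, hqcyc, hqv, hqe⟩ := hS'.exists_walk_of_adj hs ht (hVS' x hl.left_mem)
    (hVS' y hl.right_mem) fun hc => hst (hφ hc)
  set P' : β → G.Subgraph := Function.update P e q.toSubgraph with hP'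
  have hP'e : P' e = q.toSubgraph := Function.update_self _ _ _
  have hP'f : ∀ f, f ≠ e → P' f = P f := fun f hf => Function.update_of_ne hf _ _
  have hxP : φ x ∈ (P e).verts := by simp [hS]
  have hyP : φ y ∈ (P e).verts := by simp [hS]
  have hends : ∀ w ∈ q.toSubgraph.verts, w ∉ S' → w ∈ (P e).verts ∧ w ∉ S := by
    intro w hw hwS
    rw [hqv] at hw
    rcases hw with (rfl | rfl) | hw
    exacts [⟨hxP, hxS⟩, ⟨hyP, hyS⟩, (hwS hw).elim]
  have hP'v : ∀ f ∈ R.edgeSet, (P' f).verts ⊆ (H.verts \ S) ∪ S' := by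
    intro f hf w hw
    by_cases hfe : f = e
    · subst hfe
      rw [hP'e] at hw
      by_cases hwS : w ∈ S'
      · exact .inr hwS
      · exact .inl ⟨hPH _ heR (hends w hw hwS).1, (hends w hw hwS).2⟩
    · rw [hP'f f hfe] at hw
      exact .inl ⟨hPH f hf hw, hfS f hf hfe w hw⟩
  have hcommon : ∀ f ∈ R.edgeSet, f ≠ e → ∀ w ∈ (P' e).verts ∩ (P f).verts,
      ∃ z, R.Inc e z ∧ R.Inc f z ∧ φ z = w := by
    rintro f hf hfe w ⟨hw, hwf⟩
    rw [hP'e] at hw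
    exact h.internally_disjoint e heR f hf hfe.symm w
      ⟨(hends w hw (hfS' f hf hfe w hwf)).1, hwf⟩
  have hedge : ∀ f ∈ R.edgeSet, f ≠ e → Disjoint (P' e).edgeSet (P f).edgeSet := by
    intro f hf hfe
    rw [Set.disjoint_left]
    intro z
    induction z with
    | _ a b =>
      intro hz hz'
      rw [hP'e] at hz
      rw [SimpleGraph.Subgraph.mem_edgeSet] at hz hz'
      rcases hqe a b hz with ha | hb
      · exact hfS' f hf hfe a hz'.fst_mem ha
      · exact hfS' f hf hfe b hz'.snd_mem hb
  refine ⟨{ verts := (H.verts \ S) ∪ S'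
            Adj := fun a b => ∃ f ∈ R.edgeSet, (P' f).Adj a b
            adj_sub := fun ⟨f, _, hf⟩ => hf.adj_sub
            edge_vert := fun ⟨f, hfR, hf⟩ => hP'v f hfR hf.fst_mem
            symm := ⟨fun a b ⟨f, hfR, hf⟩ => ⟨f, hfR, hf.symm⟩⟩ }, ⟨φ, P', ?_⟩, rfl⟩
  constructor
  · exact h.branch_injOn
  · intro f x' y' hf hne
    by_cases hfe : f = e
    · subst hfe
      rw [hP'e]
      rcases hl.eq_and_eq_or_eq_and_eq hf with ⟨rfl, rfl⟩ | ⟨rfl, rfl⟩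
      · exact ⟨q, hqpath fun hc => hne (hφ hc), rfl⟩
      · exact ⟨q.reverse, (hqpath fun hc => hne (hφ hc).symm).reverse, by simp⟩
    · rw [hP'f f hfe]
      exact h.isPath f x' y' hf hne
  · intro f x' hf
    by_cases hfe : f = e
    · subst hfe
      rw [hP'e]
      have hx' := hf.eq_of_inc hl.inc_left
      have hy' := hf.eq_of_inc hl.inc_right
      subst hx'
      subst hy'
      exact ⟨q, by simpa using hqcyc rfl, rfl⟩
    · rw [hP'f f hfe]
      exact h.isCycle f x' hf
  · intro f hf z hz hzf
    by_cases hfe : f = e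
    · subst hfe
      rw [hP'e] at hzf
      exact h.branch_mem _ hf z hz (hends _ hzf (hVS' z hz)).1
    · rw [hP'f f hfe] at hzf
      exact h.branch_mem f hf z hz hzf
  · intro f hf g hg hfg w hw
    by_cases hfe : f = e
    · subst hfe
      rw [hP'f g hfg.symm] at hw
      exact hcommon g hg hfg.symm w hw
    by_cases hge : g = e
    · subst hge
      rw [hP'f f hfe] at hw
      obtain ⟨z, h1, h2, h3⟩ := hcommon f hf hfe w hw.symm
      exact ⟨z, h2, h1, h3⟩
    rw [hP'f f hfe, hP'f g hge] at hw
    exact h.internally_disjoint f hf g hg hfg w hw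
  · intro f hf g hg hfg
    by_cases hfe : f = e
    · subst hfe
      rw [hP'f g hfg.symm]
      exact hedge g hg hfg.symm
    by_cases hge : g = e
    · subst hge
      rw [hP'f f hfe]
      exact (hedge f hf hfe).symm
    rw [hP'f f hfe, hP'f g hge]
    exact h.edge_disjoint f hf g hg hfg
  · refine subset_antisymm ?_ (union_subset ?_ (iUnion₂_subset hP'v))
    · rintro w (⟨hw, hwS⟩ | hw)
      · rw [h.verts_eq] at hw
        refine hw.imp_right fun hw => ?_
        rw [mem_iUnion₂] at hw ⊢
        obtain ⟨f, hf, hw⟩ := hw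
        refine ⟨f, hf, ?_⟩
        by_cases hfe : f = e
        · subst hfe
          rw [hP'e, hqv]
          rw [hS] at hw
          exact .inl (hw.resolve_right hwS)
        · rw [hP'f f hfe]
          exact hw
      · refine .inr (mem_iUnion₂.2 ⟨e, heR, ?_⟩)
        rw [hP'e, hqv]
        exact .inr hw
    · rintro _ ⟨z, hz, rfl⟩
      exact .inl ⟨hVH ⟨z, hz, rfl⟩, hVS z hz⟩
  · ext z
    induction z with
    | _ a b => simp [SimpleGraph.Subgraph.mem_edgeSet]

end IsSubdivisionModel

/-- The nonempty set `S` is the vertex set of a path inside of `X` that cannot be replaced by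
another path with the same ends so that the number of vertices of `X` increases. -/
def IsOptimalPart {W : Type*} (G : SimpleGraph W) (X S : Set W) : Prop :=
  S ⊆ X ∧ ∃ s t, PathOn G s t S ∧ ∀ Z, PathOn G s t Z → Disjoint Z (X \ S) →
    ((X \ S) ∪ Z).ncard ≤ X.ncard

/-- The parts are the interiors of the subdivided edges. A better path in place of one of them would
give a larger subdivision by `exists_replace`. -/
lemma IsMaximumSubdivision.exists_parts {α β W : Type*} {G : SimpleGraph W} {R : Graph α β}
    {X : G.Subgraph} (h : IsMaximumSubdivision R X) :
    ∃ (φ : α → W) (S : β → Set W), (∀ e ∈ R.edgeSet, S e = ∅ ∨ IsOptimalPart G X.verts (S e)) ∧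
      X.verts ⊆ φ '' R.vertexSet ∪ ⋃ e ∈ R.edgeSet, S e := by
  classical
  obtain ⟨⟨φ, P, hm⟩, hmax⟩ := h
  have hex : ∀ e, ∃ S, e ∈ R.edgeSet → (S = ∅ ∨ IsOptimalPart G X.verts S) ∧
      (P e).verts ⊆ φ '' R.vertexSet ∪ S := by
    intro e
    by_cases he : e ∈ R.edgeSet
    · obtain ⟨x, y, hl⟩ := Graph.exists_isLink_of_mem_edgeSet he
      obtain ⟨S, h1, h2, h3, h4⟩ := hm.exists_interior hl
      refine ⟨S, fun _ => ⟨h4.imp_right ?_, ?_⟩⟩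
      · rintro ⟨s, t, hS, hs, ht, hst⟩
        refine ⟨?_, s, t, hS, fun Z hZ hd => ?_⟩
        · rw [hm.verts_eq]
          refine subset_trans ?_ ((subset_biUnion_of_mem (u := fun f => (P f).verts) he).trans
            subset_union_right)
          simp only [h1]
          exact subset_union_right
        · obtain ⟨K, hK, hKv⟩ := hm.exists_replace hl h1 h2 h3 hs ht hst hZ hd
          rw [← hKv]
          exact hmax K hK
      · rw [h1]
        refine union_subset_union_left _ ?_
        rintro _ (rfl | rfl)
        exacts [⟨x, hl.left_mem, rfl⟩, ⟨y, hl.right_mem, rfl⟩]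
    · exact ⟨∅, fun h => (he h).elim⟩
  choose S hS using hex
  refine ⟨φ, S, fun e he => (hS e he).1, ?_⟩
  rw [hm.verts_eq]
  refine union_subset subset_union_left (iUnion₂_subset fun e he => ?_)
  exact (hS e he).2.trans (union_subset_union_right _ (subset_biUnion_of_mem (u := S) he))

/-! ### Counting all links and choosing the constant -/

lemma card_sq_le_of_isOptimalPart {W ι : Type*} [Finite W] {G : SimpleGraph W} {X Y S S' : Set W}
    (hS : IsOptimalPart G X S) (hS' : IsOptimalPart G Y S') {T : Finset ι} {a b : ι → W}
    {F : ι → Set W} (hF : ∀ t ∈ T, PathOn G (a t) (b t) (F t))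
    (hX : ∀ t ∈ T, F t ∩ X = {a t}) (hY : ∀ t ∈ T, F t ∩ Y = {b t})
    (ha : ∀ t ∈ T, a t ∈ S) (hb : ∀ t ∈ T, b t ∈ S') (hab : ∀ t ∈ T, a t ∉ Y)
    (hd : ∀ t ∈ T, ∀ u ∈ T, t ≠ u → Disjoint (F t) (F u)) :
    T.card ^ 2 ≤ 12 * ((X ∩ Y).ncard + 1) ^ 3 := by
  classical
  obtain ⟨hSX, s, t, hst, hmax⟩ := hS
  obtain ⟨hSY, s', t', hst', hmax'⟩ := hS'
  obtain ⟨f, n, hf, rfl, rfl, rfl⟩ := hst.exists_isTrack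
  obtain ⟨g, n', hg, rfl, rfl, rfl⟩ := hst'.exists_isTrack
  have hx : ∀ t, ∃ i, t ∈ T → i ≤ n ∧ f i = a t := fun t => by
    by_cases ht : t ∈ T
    · obtain ⟨i, hi, h⟩ := ha t ht
      exact ⟨i, fun _ => ⟨hi.2, h⟩⟩
    · exact ⟨0, fun h => (ht h).elim⟩
  have hy : ∀ t, ∃ i, t ∈ T → i ≤ n' ∧ g i = b t := fun t => by
    by_cases ht : t ∈ T
    · obtain ⟨i, hi, h⟩ := hb t ht
      exact ⟨i, fun _ => ⟨hi.2, h⟩⟩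
    · exact ⟨0, fun h => (ht h).elim⟩
  choose x hx using hx
  choose y hy using hy
  have haX : ∀ t ∈ T, a t ∈ X := fun t ht => hSX (ha t ht)
  have hbY : ∀ t ∈ T, b t ∈ Y := fun t ht => hSY (hb t ht)
  have hne : ∀ t ∈ T, a t ≠ b t := fun t ht h => hab t ht (h ▸ hbY t ht)
  have hba : ∀ t ∈ T, b t ∉ X := fun t ht h => by
    have : b t ∈ F t ∩ X := ⟨(hF t ht).right_mem, h⟩
    rw [hX t ht] at this
    exact hne t ht this.symm
  have L : IsLinkSystem G X Y f g n n' (T : Set ι) x y fun t => F t \ {a t, b t} :=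
    { track_f := hf
      track_g := hg
      f_mem := fun i hi => hSX ⟨i, ⟨Nat.zero_le _, hi⟩, rfl⟩
      g_mem := fun i hi => hSY ⟨i, ⟨Nat.zero_le _, hi⟩, rfl⟩
      max_f := hmax
      max_g := hmax'
      x_le := fun t ht => (hx t ht).1
      y_le := fun t ht => (hy t ht).1
      x_notMem := fun t ht => by
        rw [(hx t ht).2]
        exact hab t ht
      y_notMem := fun t ht => by
        rw [(hy t ht).2]
        exact hba t ht
      joined := fun t ht => by
        rw [(hx t ht).2, (hy t ht).2]
        refine ⟨hne t ht, by simp, by simp, ?_⟩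
        convert hF t ht using 1
        ext z
        have h1 := (hF t ht).left_mem
        have h2 := (hF t ht).right_mem
        simp only [mem_insert_iff, mem_sdiff, mem_singleton_iff]
        grind
      disj := fun t ht => by
        rw [Set.disjoint_left]
        rintro z ⟨hz, hz'⟩ (h | h)
        · exact hz' (.inl (by simpa using (hX t ht).subset ⟨hz, h⟩))
        · exact hz' (.inr (by simpa using (hY t ht).subset ⟨hz, h⟩))
      pairwise := fun t ht u hu htu => (hd t ht u hu htu).mono sdiff_subset sdiff_subset
      x_inj := fun t ht u hu h => by
        by_contra htu
        refine (hd t ht u hu htu).le_bot ⟨(hF t ht).left_mem, ?_⟩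
        rw [← (hx t ht).2, h, (hx u hu).2]
        exact (hF u hu).left_mem
      y_inj := fun t ht u hu h => by
        by_contra htu
        refine (hd t ht u hu htu).le_bot ⟨(hF t ht).right_mem, ?_⟩
        rw [← (hy t ht).2, h, (hy u hu).2]
        exact (hF u hu).right_mem }
  exact L.card_sq_le

/-- A bound for the number of disjoint paths between two sets that are covered by few vertices and
few optimal parts. -/
lemma card_links_le {W β : Type*} [Finite W] {G : SimpleGraph W} {X Y B B' : Set W}
    {E : Finset β} {S S' : β → Set W} {k r : ℕ}
    (hS : ∀ e ∈ E, S e = ∅ ∨ IsOptimalPart G X (S e))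
    (hS' : ∀ e ∈ E, S' e = ∅ ∨ IsOptimalPart G Y (S' e))
    (hX : X ⊆ B ∪ ⋃ e ∈ E, S e) (hY : Y ⊆ B' ∪ ⋃ e ∈ E, S' e)
    (hB : B.ncard ≤ r) (hB' : B'.ncard ≤ r) {a b : Fin k → W} {F : Fin k → Set W}
    (hF : ∀ t, PathOn G (a t) (b t) (F t)) (hFX : ∀ t, F t ∩ X = {a t})
    (hFY : ∀ t, F t ∩ Y = {b t}) (hd : ∀ t u, t ≠ u → Disjoint (F t) (F u)) :
    k ≤ (X ∩ Y).ncard + r + r + E.card * E.card * Nat.sqrt (12 * ((X ∩ Y).ncard + 1) ^ 3) := by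
  classical
  have haX : ∀ t, a t ∈ X := fun t => ((hFX t).symm.subset rfl).2
  have hbY : ∀ t, b t ∈ Y := fun t => ((hFY t).symm.subset rfl).2
  have hainj : Function.Injective a := by
    intro t u h
    by_contra htu
    exact (hd t u htu).le_bot ⟨(hF t).left_mem, h ▸ (hF u).left_mem⟩
  have hbinj : Function.Injective b := by
    intro t u h
    by_contra htu
    exact (hd t u htu).le_bot ⟨(hF t).right_mem, h ▸ (hF u).right_mem⟩
  -- Links are sorted into those starting in `X ∩ Y`, those with an end in an exceptional set `B` or
  -- `B'`, and the rest according to the pair of parts they join.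
  let T₀ : Finset (Fin k) := Finset.univ.filter fun t => a t ∈ Y
  let T₁ : Finset (Fin k) := Finset.univ.filter fun t => a t ∈ B
  let T₂ : Finset (Fin k) := Finset.univ.filter fun t => b t ∈ B'
  let T₃ : β × β → Finset (Fin k) := fun p =>
    Finset.univ.filter fun t => a t ∉ Y ∧ a t ∈ S p.1 ∧ b t ∈ S' p.2
  have h0 : T₀.card ≤ (X ∩ Y).ncard := by
    rw [← Set.ncard_coe_finset]
    refine Set.ncard_le_ncard_of_injOn a (fun t ht => ⟨haX t, ?_⟩) hainj.injOn
    simpa [T₀] using ht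
  have h1 : T₁.card ≤ r := by
    rw [← Set.ncard_coe_finset]
    refine (Set.ncard_le_ncard_of_injOn a (fun t ht => ?_) hainj.injOn).trans hB
    simpa [T₁] using ht
  have h2 : T₂.card ≤ r := by
    rw [← Set.ncard_coe_finset]
    refine (Set.ncard_le_ncard_of_injOn b (fun t ht => ?_) hbinj.injOn).trans hB'
    simpa [T₂] using ht
  have h3 : ∀ p ∈ E ×ˢ E, (T₃ p).card ≤ Nat.sqrt (12 * ((X ∩ Y).ncard + 1) ^ 3) := by
    intro p hp
    rw [Finset.mem_product] at hp
    have hm : ∀ t ∈ T₃ p, a t ∉ Y ∧ a t ∈ S p.1 ∧ b t ∈ S' p.2 := fun t ht => by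
      simpa [T₃] using ht
    rw [Nat.le_sqrt']
    rcases (T₃ p).eq_empty_or_nonempty with he | ⟨t, ht⟩
    · simp [he]
    have hne : (S p.1).Nonempty := ⟨_, (hm t ht).2.1⟩
    have hne' : (S' p.2).Nonempty := ⟨_, (hm t ht).2.2⟩
    exact card_sq_le_of_isOptimalPart ((hS p.1 hp.1).resolve_left hne.ne_empty)
      ((hS' p.2 hp.2).resolve_left hne'.ne_empty) (fun t _ => hF t) (fun t _ => hFX t)
      (fun t _ => hFY t) (fun t ht => (hm t ht).2.1) (fun t ht => (hm t ht).2.2)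
      (fun t ht => (hm t ht).1) (fun t _ u _ h => hd t u h)
  have hcover : (Finset.univ : Finset (Fin k)) ⊆ T₀ ∪ T₁ ∪ T₂ ∪ (E ×ˢ E).biUnion T₃ := by
    intro t _
    simp only [Finset.mem_union, Finset.mem_biUnion, Finset.mem_product, T₀, T₁, T₂, T₃,
      Finset.mem_filter, Finset.mem_univ, true_and]
    by_cases hc0 : a t ∈ Y
    · exact .inl (.inl (.inl hc0))
    rcases hX (haX t) with hc1 | hc1
    · exact .inl (.inl (.inr hc1))
    rcases hY (hbY t) with hc2 | hc2
    · exact .inl (.inr hc2)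
    rw [mem_iUnion₂] at hc1 hc2
    obtain ⟨e, he, hae⟩ := hc1
    obtain ⟨e', he', hbe⟩ := hc2
    exact .inr ⟨(e, e'), ⟨he, he'⟩, hc0, hae, hbe⟩
  have hcard := Finset.card_le_card hcover
  rw [Finset.card_univ, Fintype.card_fin] at hcard
  have u1 := Finset.card_union_le (T₀ ∪ T₁ ∪ T₂) ((E ×ˢ E).biUnion T₃)
  have u2 := Finset.card_union_le (T₀ ∪ T₁) T₂
  have u3 := Finset.card_union_le T₀ T₁
  have u4 := Finset.card_biUnion_le_card_mul _ _ _ h3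
  rw [Finset.card_product] at u4
  omega

/-- A separator of minimum size and disjoint paths between two sets, as many as its vertices. -/
lemma exists_separator_and_links {W : Type*} [Finite W] (G : SimpleGraph W) (X Y : Set W) :
    ∃ S : Set W, SeparatesSets G S X Y ∧ ∃ (a b : Fin S.ncard → W) (F : Fin S.ncard → Set W),
      (∀ t, PathOn G (a t) (b t) (F t)) ∧ (∀ t, F t ∩ X = {a t}) ∧ (∀ t, F t ∩ Y = {b t}) ∧
      ∀ t u, t ≠ u → Disjoint (F t) (F u) := by
  classical
  have hex : ∃ n, ∃ S : Set W, WalkSeparates G S X Y ∧ S.ncard = n :=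
    ⟨_, X, fun a ha b hb p => ⟨a, p.start_mem_support, ha⟩, rfl⟩
  obtain ⟨S, hS, hSn⟩ := Nat.find_spec hex
  obtain ⟨F, hF, hd⟩ := exists_disjoint_paths G X Y S.ncard fun Z hZ => by
    rw [hSn]
    exact Nat.find_min' hex ⟨Z, hZ, rfl⟩
  have hF' : ∀ t, ∃ a ∈ X, ∃ b ∈ Y, ∃ F' ⊆ F t, PathOn G a b F' ∧ F' ∩ X = {a} ∧ F' ∩ Y = {b} := by
    intro t
    obtain ⟨a, ha, b, hb, h⟩ := hF t
    exact h.exists_subset_inter_eq ha hb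
  choose a ha b hb F' hF' hp hX hY using hF'
  refine ⟨S, fun u v p hp => hS u ?_ v ?_ p, a, b, F', hp, hX, hY, fun t u htu =>
    (hd htu).mono (hF' t) (hF' u)⟩
  · exact (hp.2.1.symm.subset rfl).2
  · exact (hp.2.2.symm.subset rfl).2

lemma one_le_max_rpow (m : ℕ) : (1 : ℝ) ≤ (max (m : ℝ) 1) ^ (3 / 2 : ℝ) :=
  Real.one_le_rpow (le_max_right _ _) (by norm_num)

lemma le_max_rpow (m : ℕ) : (m : ℝ) ≤ (max (m : ℝ) 1) ^ (3 / 2 : ℝ) :=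
  (le_max_left _ _).trans (Real.self_le_rpow_of_one_le (le_max_right _ _) (by norm_num))

lemma sqrt_le_max_rpow (m : ℕ) :
    (Nat.sqrt (12 * (m + 1) ^ 3) : ℝ) ≤ 10 * (max (m : ℝ) 1) ^ (3 / 2 : ℝ) := by
  set M : ℝ := max (m : ℝ) 1
  have hM : 1 ≤ M := le_max_right _ _
  have hm : (m : ℝ) ≤ M := le_max_left _ _
  have h1 : ((Nat.sqrt (12 * (m + 1) ^ 3) : ℕ) : ℝ) ^ 2 ≤ 12 * ((m : ℝ) + 1) ^ 3 := by
    exact_mod_cast Nat.sqrt_le' (12 * (m + 1) ^ 3)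
  -- This gives `12 * 8 = 96 ≤ 10 ^ 2`, whence the factor `10`.
  have h2 : ((m : ℝ) + 1) ^ 3 ≤ (2 * M) ^ 3 :=
    pow_le_pow_left₀ (by positivity) (by linarith) 3
  have h3 : (M ^ (3 / 2 : ℝ)) ^ 2 = M ^ 3 := by
    rw [← Real.rpow_natCast, ← Real.rpow_mul (by linarith), ← Real.rpow_natCast]
    norm_num
  refine le_of_sq_le_sq ?_ (by positivity)
  rw [mul_pow, h3]
  have h4 : 0 ≤ M ^ 3 := by positivity
  nlinarith

theorem IsMaximumSubdivision.exists_separator {α : Type u} {β : Type v} (R : Graph α β)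
    (hV : R.vertexSet.Finite) (hE : R.edgeSet.Finite) :
    ∃ C : ℝ, 1 ≤ C ∧ ∀ (W : Type w) [Finite W] (G : SimpleGraph W) (X Y : G.Subgraph) (m : ℕ),
        IsMaximumSubdivision R X → IsMaximumSubdivision R Y →
        (X.verts ∩ Y.verts).ncard = m →
        ∃ S : Set W, SeparatesSets G S X.verts Y.verts ∧
          (S.ncard : ℝ) ≤ C * (max (m : ℝ) 1) ^ (3 / 2 : ℝ) := by
  classical
  set r := R.vertexSet.ncard
  set h := hE.toFinset.card
  -- The summands pay for the links starting in `X ∩ Y`, for those at branch vertices of `X` or `Y`,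
  -- and for the `h * h` pairs of subdivided edges. That the constant is at least `1` serves longest
  -- paths of length zero.
  refine ⟨1 + 2 * r + 10 * (h * h), ?_, ?_⟩
  · have : (0 : ℝ) ≤ 2 * r + 10 * (h * h) := by positivity
    linarith
  intro W _ G X Y m hX hY hm
  obtain ⟨S, hS, a, b, F, hF, hFX, hFY, hd⟩ := exists_separator_and_links G X.verts Y.verts
  refine ⟨S, hS, ?_⟩
  obtain ⟨φ, A, hA, hXA⟩ := hX.exists_parts
  obtain ⟨ψ, A', hA', hYA'⟩ := hY.exists_parts
  have hk := card_links_le (E := hE.toFinset) (S := A) (S' := A') (r := r)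
    (fun e he => hA e (by simpa using he)) (fun e he => hA' e (by simpa using he))
    (by simpa using hXA) (by simpa using hYA') (Set.ncard_image_le hV) (Set.ncard_image_le hV)
    hF hFX hFY hd
  rw [hm] at hk
  have hk' : (S.ncard : ℝ) ≤ m + r + r + h * h * (Nat.sqrt (12 * (m + 1) ^ 3) : ℝ) := by
    exact_mod_cast hk
  have b1 := one_le_max_rpow m
  have b2 := le_max_rpow m
  have b3 := sqrt_le_max_rpow m
  set K : ℝ := (max (m : ℝ) 1) ^ (3 / 2 : ℝ)
  have b4 : (r : ℝ) ≤ r * K := le_mul_of_one_le_right (by positivity) b1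
  have b5 : (h * h : ℝ) * (Nat.sqrt (12 * (m + 1) ^ 3) : ℝ) ≤ h * h * (10 * K) :=
    mul_le_mul_of_nonneg_left b3 (by positivity)
  linarith

/-! ### Longest paths as maximum subdivisions of a single edge -/

/-- The multigraph with two vertices and one edge joining them. -/
def singleEdge : Graph (ULift.{u} Bool) PUnit.{v + 1} :=
  Graph.banana ⟨false⟩ ⟨true⟩ univ

lemma singleEdge_isLink {e : PUnit.{v + 1}} {x y : ULift.{u} Bool} :
    singleEdge.IsLink e x y ↔ x ≠ y := by
  change (e ∈ univ ∧ (x = ⟨false⟩ ∧ y = ⟨true⟩ ∨ x = ⟨true⟩ ∧ y = ⟨false⟩)) ↔ x ≠ y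
  rcases x with ⟨_ | _⟩ <;> rcases y with ⟨_ | _⟩ <;> simp

lemma singleEdge_mem_edgeSet (e : PUnit.{v + 1}) : e ∈ singleEdge.{u, v}.edgeSet :=
  (singleEdge_isLink.2 (show (⟨false⟩ : ULift.{u} Bool) ≠ ⟨true⟩ by simp)).edge_mem

lemma singleEdge_inc (e : PUnit.{v + 1}) (x : ULift.{u} Bool) : singleEdge.Inc e x := by
  rcases x with ⟨_ | _⟩
  · exact ⟨⟨true⟩, singleEdge_isLink.2 (by simp)⟩
  · exact ⟨⟨false⟩, singleEdge_isLink.2 (by simp)⟩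

lemma SimpleGraph.Walk.IsPath.ncard_support {W : Type*} {G : SimpleGraph W} {a b : W}
    {p : G.Walk a b} (hp : p.IsPath) : {v | v ∈ p.support}.ncard = p.length + 1 := by
  classical
  have : {v | v ∈ p.support} = (p.support.toFinset : Set W) := by
    ext
    simp
  rw [this, Set.ncard_coe_finset, List.toFinset_card_of_nodup hp.support_nodup,
    SimpleGraph.Walk.length_support]

lemma isSubdivision_singleEdge_toSubgraph {W : Type*} {G : SimpleGraph W} {a b : W}
    {p : G.Walk a b} (hp : p.IsPath) (hab : a ≠ b) :
    IsSubdivision singleEdge.{u, v} p.toSubgraph := by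
  let φ : ULift.{u} Bool → W := fun z => if z.down then b else a
  have hφ : ∀ z, φ z ∈ p.toSubgraph.verts := by
    rintro ⟨_ | _⟩ <;> simp [φ]
  refine ⟨φ, fun _ => p.toSubgraph, ?_⟩
  constructor
  · rintro ⟨_ | _⟩ - ⟨_ | _⟩ - h
    · rfl
    · exact (hab (by simpa [φ] using h)).elim
    · exact (hab (by simpa [φ] using h.symm)).elim
    · rfl
  · rintro e ⟨_ | _⟩ ⟨_ | _⟩ - hne
    · exact (hne rfl).elim
    · exact ⟨p, hp, rfl⟩
    · exact ⟨p.reverse, hp.reverse, p.toSubgraph_reverse⟩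
    · exact (hne rfl).elim
  · exact fun e x hx => (singleEdge_isLink.1 hx rfl).elim
  · exact fun e _ z _ _ => singleEdge_inc e z
  · exact fun e _ f _ hef => (hef (Subsingleton.elim _ _)).elim
  · exact fun e _ f _ hef => (hef (Subsingleton.elim _ _)).elim
  · apply subset_antisymm
    · intro w hw
      exact .inr (mem_iUnion₂.2 ⟨PUnit.unit, singleEdge_mem_edgeSet _, hw⟩)
    · refine union_subset ?_ (iUnion₂_subset fun _ _ => subset_rfl)
      rintro _ ⟨z, -, rfl⟩
      exact hφ z
  · apply subset_antisymm
    · intro w hw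
      exact mem_iUnion₂.2 ⟨PUnit.unit, singleEdge_mem_edgeSet _, hw⟩
    · exact iUnion₂_subset fun _ _ => subset_rfl

/-- A subdivision of a single edge is a path between distinct vertices, so paths of length zero must
be excluded. -/
lemma IsLongestPath.isMaximumSubdivision {W : Type*} {G : SimpleGraph W} {a b : W}
    {p : G.Walk a b} (hp : IsLongestPath p) (hl : p.length ≠ 0) :
    IsMaximumSubdivision singleEdge.{u, v} p.toSubgraph := by
  have hab : a ≠ b := by
    rintro rfl
    refine hl ?_
    rw [(SimpleGraph.Walk.isPath_iff_nil.1 hp.1).eq_nil]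
    rfl
  refine ⟨isSubdivision_singleEdge_toSubgraph hp.1 hab, ?_⟩
  rintro K ⟨φ, P, hm⟩
  obtain ⟨q, hq, hqP⟩ := hm.isPath PUnit.unit ⟨false⟩ ⟨true⟩ (singleEdge_isLink.2 (by simp))
    (by simp)
  have hK : K.verts ⊆ {v | v ∈ q.support} := by
    rw [hm.verts_eq]
    refine union_subset ?_ (iUnion₂_subset fun e _ => ?_)
    · rintro _ ⟨⟨_ | _⟩, -, rfl⟩
      exacts [q.start_mem_support, q.end_mem_support]
    · rw [← hqP, SimpleGraph.Walk.verts_toSubgraph]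
  have hfin : {v | v ∈ q.support}.Finite := q.support.finite_toSet
  calc K.verts.ncard ≤ {v | v ∈ q.support}.ncard := Set.ncard_le_ncard hK hfin
    _ = q.length + 1 := hq.ncard_support
    _ ≤ p.length + 1 := Nat.succ_le_succ (hp.2 _ _ q hq)
    _ = p.toSubgraph.verts.ncard := by
      rw [SimpleGraph.Walk.verts_toSubgraph, hp.1.ncard_support]

theorem theorem5p2 :
    (∀ (α : Type u) (β : Type v) (R : Graph α β), R.vertexSet.Finite → R.edgeSet.Finite →
      ∃ C : ℝ, ∀ (W : Type w) [Finite W] (G : SimpleGraph W) (X Y : G.Subgraph) (m : ℕ),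
        IsMaximumSubdivision R X → IsMaximumSubdivision R Y →
        (X.verts ∩ Y.verts).ncard = m →
        ∃ S : Set W, SeparatesSets G S X.verts Y.verts ∧
          (S.ncard : ℝ) ≤ C * (max (m : ℝ) 1) ^ (3 / 2 : ℝ)) ∧
    (∃ C : ℝ, ∀ (W : Type w) [Finite W] (G : SimpleGraph W) (a b c d : W)
        (p : G.Walk a b) (q : G.Walk c d) (m : ℕ),
        IsLongestPath p → IsLongestPath q →
        ({v | v ∈ p.support} ∩ {v | v ∈ q.support}).ncard = m →
        ∃ S : Set W, SeparatesSets G S {v | v ∈ p.support} {v | v ∈ q.support} ∧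
          (S.ncard : ℝ) ≤ C * (max (m : ℝ) 1) ^ (3 / 2 : ℝ)) := by
  constructor
  · intro α β R hV hE
    obtain ⟨C, -, hC⟩ := IsMaximumSubdivision.exists_separator R hV hE
    exact ⟨C, hC⟩
  · obtain ⟨C, hC1, hC⟩ := IsMaximumSubdivision.exists_separator.{0, 0, w} singleEdge.{0, 0}
      (Set.toFinite _) (Set.toFinite _)
    refine ⟨C, fun W _ G a b c d p q m hp hq hm => ?_⟩
    -- A longest path of length zero is separated from anything by its only vertex. Otherwise both
    -- paths, having equal length, are nontrivial.
    by_cases hl : p.length = 0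
    · refine ⟨{a}, ?_, ?_⟩
      · intro a' b' r hr
        have ha' : a' ∈ p.support := (hr.2.1.symm.subset rfl).2
        have hnil : p.Nil := SimpleGraph.Walk.length_eq_zero_iff.1 hl
        rw [SimpleGraph.Walk.nil_iff_support_eq.1 hnil, List.mem_singleton] at ha'
        exact ⟨a', r.start_mem_support, ha'⟩
      · rw [Set.ncard_singleton, Nat.cast_one]
        exact one_le_mul_of_one_le_of_one_le hC1 (one_le_max_rpow m)
    · have hl' : q.length ≠ 0 := fun h0 => hl (Nat.le_zero.1 (h0 ▸ hq.2 _ _ p hp.1))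
      have := hC W G p.toSubgraph q.toSubgraph m (hp.isMaximumSubdivision hl)
        (hq.isMaximumSubdivision hl')
      simp only [SimpleGraph.Walk.verts_toSubgraph] at this
      exact this hm
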